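/- For each $n\ge 1$ let $(y_i,\boldsymbol x_i)$, $i=1,\dots,n$, be i.i.d. with $y_i\in\mathbb R$ and $\boldsymbol x_i=(1,x_{i1},\dots,x_{ip})^\top\in\mathbb R^{p+1}$, where $p=p_n$ and the law of the pairs may depend on $n$. Let $0<\tau_1<\dots<\tau_K<1$ with $K=K_n$, and let $y_i=\boldsymbol x_i^\top\boldsymbol\beta_k^*+\epsilon_i^k$ with $P(\epsilon_i^k<0\mid\boldsymbol x_i)=\tau_k$ for $k=1,\dots,K$. For $\boldsymbol\beta=(\boldsymbol\beta_1^\top,\dots,\boldsymbol\beta_K^\top)^\top\in\mathbb R^{K(p+1)}$ write $\boldsymbol\beta^j=(\beta_{1j},\dots,\beta_{Kj})\in\mathbb R^K$. Let $\mathcal S=\{j\in\{1,\dots,p\}:\|\boldsymbol\beta^{*j}\|_2\ne0\}$, $s=|\mathcal S|$, $\bar{\mathcal S}=\mathcal S\cup\{0\}$, and $$\mathcal C=\Big\{\boldsymbol\Delta\in\mathbb R^{K(p+1)}:\sum_{j\notin\bar{\mathcal S}}\|\boldsymbol\Delta^j\|_2\le 3\sum_{j\in\bar{\mathcal S}}\|\boldsymbol\Delta^j\|_2\Big\},\qquad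 \mathcal C_k=\{\boldsymbol\Delta_k:\boldsymbol\Delta\in\mathcal C\}.$$ Let $\rho_\tau(u)=u(\tau-1\{u<0\})$ and let $\hat{\boldsymbol\beta}$ be any minimizer over $\boldsymbol\beta\in\mathbb R^{K(p+1)}$ of $$\frac1n\sum_{k=1}^K\sum_{i=1}^n\rho_{\tau_k}(y_i-\boldsymbol x_i^\top\boldsymbol\beta_k)+\lambda\sum_{j=1}^p\|\boldsymbol\beta^j\|_2,\qquad \lambda=C_x\sqrt{\frac Kn}+2C_x\sqrt{\frac{D_2K\log p}{n}}.$$ Assume that there are positive constants $c_1,c_2,C_x,\tilde b,\tilde B,\tilde d$, not depending on $n$, and numbers $b_k,B_k$ with $\tilde b\le b_k$ and $B_k\le\tilde B$ ($k=1,\dots,K$), such that: (1) almost surely, the conditional law of $y_i$ given $\boldsymbol x_i$ has a differentiable density $f_i$ on $\mathbb R$ with $f_i(\boldsymbol x_i^\top\boldsymbol\beta_k^*)\ge c_1$ for all $i,k$ and $|f_i'(t)|\le c_2$ for all $i$ and all $t\in\mathbb R$; (2) $\max_{1\le i\le n,\,0\le j\le p}|x_{ij}|<C_x$ almost surely; (3)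 $b_k\|\boldsymbol v\|_2^2\le\boldsymbol v^\top E[\boldsymbol x_i\boldsymbol x_i^\top]\boldsymbol v\le B_k\|\boldsymbol v\|_2^2$ for all $k$ and all nonzero $\boldsymbol v\in\mathcal C_k$; (4) for all $k$, $$\tilde d\le\frac{c_1}{c_2\sqrt{B_k}}\inf_{\boldsymbol\Delta\in\mathcal C,\ \boldsymbol\Delta_k\ne0}\frac{E[(\boldsymbol x_i^\top\boldsymbol\Delta_k)^2]^{3/2}}{E[|\boldsymbol x_i^\top\boldsymbol\Delta_k|^3]}.$$ If $D_2>1$ is a constant and, as $n\to\infty$, $p\to\infty$, $s\log p=o(n)$, $K=O(1)$, and $s\ge1$ for all large $n$, then $$\|\hat{\boldsymbol\beta}-\boldsymbol\beta^*\|_2=O_P\left(\sqrt{\frac{sK\log p}{n}}\right).$$ -/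

import Mathlib

open MeasureTheory ProbabilityTheory Filter Asymptotics
open scoped Topology ENNReal Matrix

noncomputable section

namespace GQLasso

/-- Coefficient vectors `β = (β_1ᵀ, …, β_Kᵀ)ᵀ ∈ ℝ^{K(p+1)}` with the Euclidean norm. The entry
`β (k, j)` is the coefficient of predictor `j` (with `j = 0` the intercept) for the `k`-th
quantile. -/
abbrev Coef (K p : ℕ) : Type := EuclideanSpace ℝ (Fin K × Fin (p + 1))

/-- The block `β_k ∈ ℝ^{p+1}` of coefficients for the `k`-th quantile. -/
def block {K p : ℕ} (β : Coef K p) (k : Fin K) : EuclideanSpace ℝ (Fin (p + 1)) :=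
  WithLp.toLp 2 fun j => β (k, j)

/-- The group `β^j ∈ ℝ^K` of coefficients of predictor `j` for all the quantiles. -/
def group {K p : ℕ} (β : Coef K p) (j : Fin (p + 1)) : EuclideanSpace ℝ (Fin K) :=
  WithLp.toLp 2 fun k => β (k, j)

/-- The linear predictor `xᵀ β_k`. -/
def linPred {K p : ℕ} (x : Fin (p + 1) → ℝ) (β : Coef K p) (k : Fin K) : ℝ :=
  ∑ j, x j * β (k, j)

/-- The quantile (check) loss `ρ_τ(u) = u (τ - 1{u < 0})`. -/
def rho (τ u : ℝ) : ℝ := u * (τ - if u < 0 then 1 else 0)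

/-- The objective function
`(1/n) ∑_k ∑_i ρ_{τ_k}(y_i - x_iᵀ β_k) + lam ∑_{j=1}^p ‖β^j‖₂`; the intercepts are not
penalized. -/
def objective {n K p : ℕ} (τ : Fin K → ℝ) (lam : ℝ) (x : Fin n → Fin (p + 1) → ℝ)
    (y : Fin n → ℝ) (β : Coef K p) : ℝ :=
  (1 / (n : ℝ)) * (∑ k, ∑ i, rho (τ k) (y i - linPred (x i) β k))
    + lam * ∑ j : Fin p, ‖group β j.succ‖

open Classical in
/-- The set of active predictors, `{j ∈ {1, …, p} | ‖β^j‖₂ ≠ 0}`, as indices in `{0, …, p}`. -/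
def activeSet {K p : ℕ} (β : Coef K p) : Finset (Fin (p + 1)) :=
  Finset.univ.filter fun j => j ≠ 0 ∧ ‖group β j‖ ≠ 0

/-- The active predictors together with the intercept. -/
def activeSetBar {K p : ℕ} (β : Coef K p) : Finset (Fin (p + 1)) :=
  insert 0 (activeSet β)

/-- The cone of all `Δ` with `∑_{j ∉ S̄} ‖Δ^j‖₂ ≤ 3 ∑_{j ∈ S̄} ‖Δ^j‖₂`, where `S̄` is the set of
active predictors of `βstar` together with the intercept. -/
def cone {K p : ℕ} (βstar : Coef K p) : Set (Coef K p) :=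
  {Δ | ∑ j ∈ (activeSetBar βstar)ᶜ, ‖group Δ j‖ ≤ 3 * ∑ j ∈ activeSetBar βstar, ‖group Δ j‖}

/-- The set of the `k`-th blocks `Δ_k` of the elements `Δ` of the cone. -/
def coneBlock {K p : ℕ} (βstar : Coef K p) (k : Fin K) : Set (EuclideanSpace ℝ (Fin (p + 1))) :=
  (fun Δ => block Δ k) '' cone βstar

/-- The second moment matrix `E[x xᵀ]`. -/
def secondMoment {Ω : Type*} [MeasurableSpace Ω] (μ : Measure Ω) {p : ℕ}
    (x : Ω → Fin (p + 1) → ℝ) : Matrix (Fin (p + 1)) (Fin (p + 1)) ℝ :=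
  Matrix.of fun a b => ∫ ω, x ω a * x ω b ∂μ

/-- The pairs `(x_i, y_i)`, `i = 1, …, n`, are independent and identically distributed random
vectors, and `x_i = (1, x_{i1}, …, x_{ip})`. -/
def IsIIDSample {Ω : Type*} [MeasurableSpace Ω] (μ : Measure Ω) {n p : ℕ}
    (x : Fin n → Ω → Fin (p + 1) → ℝ) (y : Fin n → Ω → ℝ) : Prop :=
  (∀ i, Measurable (x i)) ∧ (∀ i, Measurable (y i)) ∧
  iIndepFun (fun i ω => (x i ω, y i ω)) μ ∧
  (∀ i i', IdentDistrib (fun ω => (x i ω, y i ω)) (fun ω => (x i' ω, y i' ω)) μ μ) ∧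
  ∀ i, ∀ᵐ ω ∂μ, x i ω 0 = 1

/-- The quantile regression model `y_i = x_iᵀ β*_k + ε_i^k` with `P(ε_i^k < 0 | x_i) = τ_k` for
quantile levels `0 < τ_1 < … < τ_K < 1`. -/
def IsQuantileModel {Ω : Type*} [MeasurableSpace Ω] (μ : Measure Ω) {n K p : ℕ}
    (τ : Fin K → ℝ) (βstar : Coef K p)
    (x : Fin n → Ω → Fin (p + 1) → ℝ) (y : Fin n → Ω → ℝ) : Prop :=
  StrictMono τ ∧ (∀ k, 0 < τ k ∧ τ k < 1) ∧
  ∀ i k, μ⟦{ω | y i ω - linPred (x i ω) βstar k < 0} |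
      MeasurableSpace.comap (x i) inferInstance⟧ =ᵐ[μ] fun _ => τ k

/-- The conditional law of `y_i` given `x_i` has a differentiable density `f` on `ℝ`, with
`f ≥ c₁` at the conditional quantiles `x_iᵀ β*_k` and `|f'| ≤ c₂` on the whole of `ℝ`. -/
def DensityCondition {Ω : Type*} [MeasurableSpace Ω] (μ : Measure Ω) [IsProbabilityMeasure μ]
    {n K p : ℕ} (βstar : Coef K p) (x : Fin n → Ω → Fin (p + 1) → ℝ) (y : Fin n → Ω → ℝ)
    (c₁ c₂ : ℝ) : Prop :=
  ∀ i, ∀ᵐ ω ∂μ, ∃ f : ℝ → ℝ, (∀ t, 0 ≤ f t) ∧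
    condDistrib (y i) (x i) μ (x i ω) = volume.withDensity (fun t => ENNReal.ofReal (f t)) ∧
    Differentiable ℝ f ∧ (∀ t, |deriv f t| ≤ c₂) ∧
    ∀ k, c₁ ≤ f (linPred (x i ω) βstar k)

/-- The predictors are bounded: `max_{i,j} |x_{ij}| < Cx` almost surely. -/
def BoundedCondition {Ω : Type*} [MeasurableSpace Ω] (μ : Measure Ω) {n p : ℕ}
    (x : Fin n → Ω → Fin (p + 1) → ℝ) (Cx : ℝ) : Prop :=
  ∀ i j, ∀ᵐ ω ∂μ, |x i ω j| < Cx

/-- Restricted eigenvalue condition: for every `k`, `bt ≤ b_k`, `B_k ≤ Bt`, and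
`b_k ‖v‖₂² ≤ vᵀ E[x_i x_iᵀ] v ≤ B_k ‖v‖₂²` for all nonzero `k`-th blocks `v` of elements of the
cone. -/
def EigenvalueCondition {Ω : Type*} [MeasurableSpace Ω] (μ : Measure Ω) {n K p : ℕ}
    (βstar : Coef K p) (x : Fin n → Ω → Fin (p + 1) → ℝ) (b B : Fin K → ℝ) (bt Bt : ℝ) : Prop :=
  ∀ i k, bt ≤ b k ∧ B k ≤ Bt ∧ ∀ v ∈ coneBlock βstar k, v ≠ 0 →
    b k * ‖v‖ ^ 2 ≤ v.ofLp ⬝ᵥ (secondMoment μ (x i) *ᵥ v.ofLp) ∧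
    v.ofLp ⬝ᵥ (secondMoment μ (x i) *ᵥ v.ofLp) ≤ B k * ‖v‖ ^ 2

/-- Restricted nonlinearity condition: for every `k`, the infimum over all `Δ` in the cone with
`Δ_k ≠ 0` of `(c₁ / (c₂ √B_k)) E[(x_iᵀ Δ_k)²]^{3/2} / E[|x_iᵀ Δ_k|³]` is at least `dt`. -/
def NonlinearityCondition {Ω : Type*} [MeasurableSpace Ω] (μ : Measure Ω) {n K p : ℕ}
    (βstar : Coef K p) (x : Fin n → Ω → Fin (p + 1) → ℝ) (B : Fin K → ℝ) (c₁ c₂ dt : ℝ) : Prop :=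
  ∀ i k, ∀ Δ ∈ cone βstar, block Δ k ≠ 0 →
    dt ≤ c₁ / (c₂ * Real.sqrt (B k)) *
      ((∫ ω, (linPred (x i ω) Δ k) ^ 2 ∂μ) ^ (3 / 2 : ℝ) /
        ∫ ω, |linPred (x i ω) Δ k| ^ 3 ∂μ)

/-- `Z n = O_P(r n)` as `n → ∞`, the variable `Z n` being defined on its own probability space:
for every `ε > 0` there is an `M` with `P(|Z n| > M r n) ≤ ε` for all large `n`. -/
def IsBigOP {Ω : ℕ → Type*} [∀ n, MeasurableSpace (Ω n)] (μ : ∀ n, Measure (Ω n))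
    (Z : ∀ n, Ω n → ℝ) (r : ℕ → ℝ) : Prop :=
  ∀ ε : ℝ, 0 < ε → ∃ M : ℝ, 0 < M ∧ ∀ᶠ n in atTop,
    μ n {ω | M * r n < |Z n ω|} ≤ ENNReal.ofReal ε

end GQLasso

end

/-!
The estimator lies within `r = M √(s K log p / n)` of the truth because the expected loss is
strongly convex on the cone, and on an event of large probability neither the noise nor the penalty
can compensate for this at distance `r`.

* The error is in the cone. Every coordinate of the score of the empirical loss at `βstar` is,
  given the predictors, a sum of centred Bernoulli variables scaled by numbers below `Cx`
  (`hasSubgaussianMGF_score`). Hoeffding's inequality and a union bound over the `K (p + 1)`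
  coordinates make `lam / 2` dominate the score in every group, and the usual comparison of the
  objective at the estimator and at `βstar` gives the cone condition (`mem_cone_of_objective_le`).
* Curvature. By Knight's identity the increase of the check loss is a linear term of mean zero plus
  a nonnegative remainder; conditionally on the predictors the mean of the remainder is at least
  `c₁ v² / 2 - c₂ |v|³ / 6` with `v = xᵀ Δ_k` (`le_integral_excessLoss`). The nonlinearity and
  eigenvalue conditions turn this into `c₁ bt / 3 * ‖Δ_k‖²` for `Δ` in the cone with `‖Δ‖ ≤ dt`
  (`curvature_on_cone`).
* Uniform deviations. Cone vectors of norm `r` have `ℓ¹` norm at most `4 √(s + 1) r` in each block.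
  Over such a ball, symmetrization (`integral_sup'_deviation_le`), contraction
  (`sum_signs_sup'_contraction`) and Massart's maximal inequality (`sum_signs_sup'_abs_le`) bound
  the expected maximal gap between mean and empirical loss by a multiple of `√(s log p / n) r`.
  As only boundedness in probability is claimed, Markov's inequality suffices, and since `K` is
  bounded the quantiles can be treated one at a time (`measure_ball_deviation_le`).

If the error were longer than `r`, convexity of the objective would give a cone vector of length
exactly `r` at which the objective is no larger than at `βstar`. There the curvature is of order
`M² (s K log p / n)`, while the deviation and the penalty are of order `M (s K log p / n)`: a
contradiction for large `M` (`curvature_le_of_objective_le`, `measure_error_le`).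
-/

namespace GQLasso

/-! ### Rademacher averages -/

/-- The sign `±1` encoded by a Boolean. Averages over independent Rademacher signs are written as
finite sums over `Fin n → Bool`. -/
def boolSign (b : Bool) : ℝ := if b then 1 else -1

@[simp] lemma boolSign_true : boolSign true = 1 := rfl

@[simp] lemma boolSign_false : boolSign false = -1 := rfl

lemma sum_signs_succ {n : ℕ} (F : (Fin (n + 1) → Bool) → ℝ) :
    ∑ ε, F ε = ∑ ε : Fin n → Bool, (F (Fin.cons true ε) + F (Fin.cons false ε)) := by
  rw [← (Fin.consEquiv fun _ : Fin (n + 1) => Bool).sum_comp, Fintype.sum_prod_type]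
  simp [Fin.consEquiv, Finset.sum_add_distrib]

/-- Contraction for a single sign: the two maxima are attained at `t` and `t'`, and
`u t - u t' ≤ |w t - w t'|` is at most one of the two differences of `w`. -/
lemma sup'_add_sup'_sub_le {ι : Type*} {T : Finset ι} (hT : T.Nonempty) (a u w : ι → ℝ)
    (h : ∀ t ∈ T, ∀ t' ∈ T, |u t - u t'| ≤ |w t - w t'|) :
    T.sup' hT (fun t => a t + u t) + T.sup' hT (fun t => a t - u t) ≤
      T.sup' hT (fun t => a t + w t) + T.sup' hT (fun t => a t - w t) := by
  obtain ⟨t, ht, hte⟩ := T.exists_mem_eq_sup' hT (fun t => a t + u t)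
  obtain ⟨t', ht', hte'⟩ := T.exists_mem_eq_sup' hT (fun t => a t - u t)
  rw [hte, hte']
  have h1 := T.le_sup' (fun t => a t + w t) ht
  have h2 := T.le_sup' (fun t => a t - w t) ht'
  have h3 := T.le_sup' (fun t => a t + w t) ht'
  have h4 := T.le_sup' (fun t => a t - w t) ht
  have h5 := (le_abs_self _).trans (h t ht t' ht')
  rcases abs_cases (w t - w t') with ⟨h6, -⟩ | ⟨h6, -⟩ <;> linarith

/-- The contraction principle for Rademacher averages over a finite index set. -/
theorem sum_signs_sup'_contraction {ι : Type*} {T : Finset ι} (hT : T.Nonempty) :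
    ∀ {n : ℕ} (a : ι → ℝ) (u w : Fin n → ι → ℝ),
      (∀ i, ∀ t ∈ T, ∀ t' ∈ T, |u i t - u i t'| ≤ |w i t - w i t'|) →
      ∑ ε : Fin n → Bool, T.sup' hT (fun t => a t + ∑ i, boolSign (ε i) * u i t) ≤
        ∑ ε : Fin n → Bool, T.sup' hT (fun t => a t + ∑ i, boolSign (ε i) * w i t) := by
  intro n
  induction n with
  | zero => intro a u w _; simp
  | succ n ih =>
    intro a u w h
    have h1 := ih (fun t => a t + u 0 t) (fun i => u i.succ) (fun i => w i.succ)
      fun i => h i.succ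
    have h2 := ih (fun t => a t - u 0 t) (fun i => u i.succ) (fun i => w i.succ)
      fun i => h i.succ
    rw [sum_signs_succ, sum_signs_succ]
    simp only [Fin.sum_univ_succ, Fin.cons_zero, Fin.cons_succ, boolSign_true, boolSign_false,
      one_mul, neg_one_mul]
    calc _ = ∑ ε : Fin n → Bool, T.sup' hT (fun t => a t + u 0 t
              + ∑ i : Fin n, boolSign (ε i) * u i.succ t)
          + ∑ ε : Fin n → Bool, T.sup' hT (fun t => a t - u 0 t
              + ∑ i : Fin n, boolSign (ε i) * u i.succ t) := by
          rw [Finset.sum_add_distrib]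
          simp only [add_assoc, sub_eq_add_neg]
      _ ≤ _ := add_le_add h1 h2
      _ = ∑ ε : Fin n → Bool,
            (T.sup' hT (fun t => (a t + ∑ i : Fin n, boolSign (ε i) * w i.succ t) + u 0 t)
            + T.sup' hT (fun t => (a t + ∑ i : Fin n, boolSign (ε i) * w i.succ t) - u 0 t)) := by
          rw [Finset.sum_add_distrib]
          simp only [add_right_comm, sub_eq_add_neg]
      _ ≤ ∑ ε : Fin n → Bool,
            (T.sup' hT (fun t => (a t + ∑ i : Fin n, boolSign (ε i) * w i.succ t) + w 0 t)
            + T.sup' hT (fun t => (a t + ∑ i : Fin n, boolSign (ε i) * w i.succ t) - w 0 t)) :=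
          Finset.sum_le_sum fun ε _ => sup'_add_sup'_sub_le hT _ _ _ (h 0)
      _ = _ := by
          refine Finset.sum_congr rfl fun ε _ => ?_
          congr 2 <;> ext t <;> ring

/-- The moment generating function of a Rademacher sum is sub-Gaussian. -/
lemma sum_signs_exp_le {n : ℕ} (a : Fin n → ℝ) {C : ℝ} (ha : ∀ i, |a i| ≤ C) (θ : ℝ) :
    ∑ ε : Fin n → Bool, Real.exp (θ * ∑ i, boolSign (ε i) * a i) ≤
      2 ^ n * Real.exp (n * (θ ^ 2 * C ^ 2 / 2)) := by
  have h1 : ∀ ε : Fin n → Bool, Real.exp (θ * ∑ i, boolSign (ε i) * a i) =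
      ∏ i, Real.exp (θ * (boolSign (ε i) * a i)) := fun ε => by
    rw [← Real.exp_sum, Finset.mul_sum]
  simp_rw [h1]
  rw [← Fintype.piFinset_univ,
    ← Finset.prod_univ_sum (fun _ : Fin n => (Finset.univ : Finset Bool))
      (fun i b => Real.exp (θ * (boolSign b * a i)))]
  have h2 : ∀ i, ∑ b : Bool, Real.exp (θ * (boolSign b * a i)) ≤
      2 * Real.exp (θ ^ 2 * C ^ 2 / 2) := fun i => by
    have h3 := Real.cosh_le_exp_half_sq (θ * a i)
    rw [Real.cosh_eq] at h3
    have h4 : Real.exp ((θ * a i) ^ 2 / 2) ≤ Real.exp (θ ^ 2 * C ^ 2 / 2) := by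
      rw [mul_pow]
      have : a i ^ 2 ≤ C ^ 2 := sq_le_sq' (abs_le.1 (ha i)).1 (abs_le.1 (ha i)).2
      gcongr
    simp only [Fintype.sum_bool, boolSign_true, boolSign_false, one_mul, neg_one_mul, mul_neg]
    linarith
  calc _ ≤ ∏ _i : Fin n, (2 * Real.exp (θ ^ 2 * C ^ 2 / 2)) :=
        Finset.prod_le_prod (fun i _ => Finset.sum_nonneg fun _ _ => (Real.exp_pos _).le)
          fun i _ => h2 i
    _ = _ := by
        rw [Finset.prod_const, Finset.card_univ, Fintype.card_fin, mul_pow, ← Real.exp_nat_mul]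

/-- Massart's maximal inequality for `d` Rademacher sums, obtained by applying Jensen's inequality
to `exp (θ ·)` at the optimal `θ`. -/
lemma sum_signs_sup'_abs_le {n d : ℕ} (hn : 0 < n) [NeZero d] (a : Fin n → Fin d → ℝ) {C : ℝ}
    (hC : 0 < C) (ha : ∀ i j, |a i j| ≤ C) :
    ∑ ε : Fin n → Bool, Finset.univ.sup' Finset.univ_nonempty
        (fun j => |∑ i, boolSign (ε i) * a i j|) ≤
      2 ^ n * (C * Real.sqrt (2 * n * Real.log (2 * d))) := by
  set X : (Fin n → Bool) → ℝ := fun ε => Finset.univ.sup' Finset.univ_nonempty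
        (fun j => |∑ i, boolSign (ε i) * a i j|) with hX
  have hd : (1 : ℝ) ≤ d := by exact_mod_cast NeZero.one_le
  have hlog : 0 < Real.log (2 * d) := Real.log_pos (by linarith)
  have hn' : (0 : ℝ) < n := by exact_mod_cast hn
  set N : ℝ := 2 ^ n with hN
  have hN0 : 0 < N := by positivity
  have key : ∀ θ : ℝ, 0 < θ →
      θ * (N⁻¹ * ∑ ε, X ε) ≤ Real.log (2 * d) + n * (θ ^ 2 * C ^ 2 / 2) := by
    intro θ hθ
    have hJ := (convexOn_exp).map_sum_le (t := (Finset.univ : Finset (Fin n → Bool)))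
      (w := fun _ => N⁻¹) (p := fun ε => θ * X ε) (fun _ _ => by positivity)
      (by simp [hN]) (fun _ _ => Set.mem_univ _)
    simp only [smul_eq_mul] at hJ
    have h1 : ∀ ε, Real.exp (θ * X ε) ≤ ∑ j, (Real.exp (θ * ∑ i, boolSign (ε i) * a i j)
        + Real.exp (-θ * ∑ i, boolSign (ε i) * a i j)) := by
      intro ε
      obtain ⟨j, -, hj⟩ := Finset.exists_mem_eq_sup' Finset.univ_nonempty
        (fun j => |∑ i, boolSign (ε i) * a i j|)
      have h2 : X ε = |∑ i, boolSign (ε i) * a i j| := hj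
      rw [h2]
      refine le_trans ?_ (Finset.single_le_sum (f := fun j =>
        Real.exp (θ * ∑ i, boolSign (ε i) * a i j)
        + Real.exp (-θ * ∑ i, boolSign (ε i) * a i j)) (fun _ _ => by positivity)
        (Finset.mem_univ j))
      rcases abs_cases (∑ i, boolSign (ε i) * a i j) with ⟨h, -⟩ | ⟨h, -⟩ <;> rw [h]
      · exact le_add_of_nonneg_right (Real.exp_pos _).le
      · rw [mul_neg, ← neg_mul]
        exact le_add_of_nonneg_left (Real.exp_pos _).le
    have h3 : ∑ ε, N⁻¹ * Real.exp (θ * X ε) ≤ 2 * d * Real.exp (n * (θ ^ 2 * C ^ 2 / 2)) := by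
      rw [← Finset.mul_sum, inv_mul_le_iff₀ hN0]
      calc ∑ ε, Real.exp (θ * X ε) ≤ _ := Finset.sum_le_sum fun ε _ => h1 ε
        _ = ∑ j, ∑ ε : Fin n → Bool, (Real.exp (θ * ∑ i, boolSign (ε i) * a i j)
              + Real.exp (-θ * ∑ i, boolSign (ε i) * a i j)) := Finset.sum_comm
        _ ≤ ∑ _j : Fin d, (2 * (N * Real.exp (n * (θ ^ 2 * C ^ 2 / 2)))) := by
            refine Finset.sum_le_sum fun j _ => ?_
            rw [Finset.sum_add_distrib]
            have e1 := sum_signs_exp_le (fun i => a i j) (fun i => ha i j) θ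
            have e2 := sum_signs_exp_le (fun i => a i j) (fun i => ha i j) (-θ)
            rw [neg_sq] at e2
            linarith
        _ = _ := by simp; ring
    have h4 := Real.log_le_log (Real.exp_pos _) (hJ.trans h3)
    rw [Real.log_exp, Real.log_mul (by positivity) (Real.exp_pos _).ne', Real.log_exp] at h4
    calc _ = ∑ ε, N⁻¹ * (θ * X ε) := by rw [Finset.mul_sum, Finset.mul_sum]
                                        exact Finset.sum_congr rfl fun _ _ => by ring
      _ ≤ _ := h4
  -- the two summands of the bound balance at `θ = √(2 log (2d) / n) / C`
  set q := Real.sqrt (2 * n * Real.log (2 * d)) with hq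
  have hq0 : 0 < q := Real.sqrt_pos.2 (by positivity)
  have hqq : q ^ 2 = 2 * n * Real.log (2 * d) := Real.sq_sqrt (by positivity)
  have h := key (q / (n * C)) (by positivity)
  have h5 : Real.log (2 * d) + n * ((q / (n * C)) ^ 2 * C ^ 2 / 2) = q / (n * C) * (C * q) := by
    have : Real.log (2 * d) = q ^ 2 / (2 * n) := by rw [hqq]; field_simp
    rw [this]; field_simp; norm_num
  rw [h5] at h
  have h6 := le_of_mul_le_mul_left h (by positivity)
  rwa [inv_mul_le_iff₀ hN0] at h6

/-! ### Symmetrization -/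

lemma integrable_finset_sup' {α ι : Type*} [MeasurableSpace α] {μ : Measure α} {T : Finset ι}
    (hT : T.Nonempty) {f : ι → α → ℝ} (hf : ∀ t ∈ T, Integrable (f t) μ) :
    Integrable (fun z => T.sup' hT fun t => f t z) μ := by
  have := Finset.sup'_induction hT f (p := fun g => Integrable g μ)
    (fun _ h1 _ h2 => h1.sup h2) hf
  refine this.congr (ae_of_all _ fun z => ?_)
  simp [Finset.sup'_apply]

lemma integrable_sum_comp_eval {α : Type*} [MeasurableSpace α] {ν : Measure α}
    [IsProbabilityMeasure ν] {n : ℕ} {h : α → ℝ} (hh : Integrable h ν) (c d : Fin n → ℝ) :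
    Integrable (fun z : Fin n → α => ∑ i, (c i + d i * h (z i)))
      (Measure.pi fun _ : Fin n => ν) :=
  integrable_finsetSum _ fun i _ => (integrable_const _).add
    (((measurePreserving_eval (fun _ : Fin n => ν) i).integrable_comp_of_integrable hh).const_mul _)

/-- Symmetrization: the expected maximal deviation between the mean and the empirical average is
at most twice the expected Rademacher average. The ghost sample consists of the second components
of a sample from `ν.prod ν`, and exchanging `z i` with its ghost where `ε i` is negative preserves
the law. -/
theorem integral_sup'_deviation_le {α ι : Type*} [MeasurableSpace α] {ν : Measure α}
    [IsProbabilityMeasure ν] {n : ℕ} {T : Finset ι} (hT : T.Nonempty) {h : ι → α → ℝ}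
    (hh : ∀ t ∈ T, Integrable (h t) ν) :
    2 ^ n * ∫ z, T.sup' hT (fun t => ∑ i, (∫ a, h t a ∂ν - h t (z i)))
        ∂(Measure.pi fun _ : Fin n => ν) ≤
      2 * ∑ ε : Fin n → Bool, ∫ z, T.sup' hT (fun t => ∑ i, boolSign (ε i) * h t (z i))
        ∂(Measure.pi fun _ : Fin n => ν) := by
  set P : Measure (Fin n → α) := Measure.pi fun _ : Fin n => ν with hP
  set Q : Measure (Fin n → α × α) := Measure.pi fun _ : Fin n => ν.prod ν with hQ
  have m1 : MeasurePreserving (fun (w : Fin n → α × α) i => (w i).1) Q P :=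
    measurePreserving_pi (fun _ => ν.prod ν) (fun _ => ν) fun _ => measurePreserving_fst
  have m2 : MeasurePreserving (fun (w : Fin n → α × α) i => (w i).2) Q P :=
    measurePreserving_pi (fun _ => ν.prod ν) (fun _ => ν) fun _ => measurePreserving_snd
  have mpair : MeasurePreserving (MeasurableEquiv.arrowProdEquivProdArrow α α (Fin n)) Q
      (P.prod P) := measurePreserving_arrowProdEquivProdArrow α α (Fin n) _ _
  have intS : ∀ c : Fin n → ℝ,
      Integrable (fun z : Fin n → α => T.sup' hT fun t => ∑ i, c i * h t (z i)) P := fun c =>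
    integrable_finset_sup' hT fun t ht => by
      simpa using integrable_sum_comp_eval (hh t ht) (fun _ => 0) c
  have intD : ∀ t ∈ T, Integrable (fun z : (Fin n → α) × (Fin n → α) =>
      ∑ i, (h t (z.2 i) - h t (z.1 i))) (P.prod P) := fun t ht => by
    have e1 : Integrable (fun z : Fin n → α => ∑ i, h t (z i)) P := by
      simpa using integrable_sum_comp_eval (n := n) (hh t ht) (fun _ => 0) (fun _ => 1)
    refine ((measurePreserving_snd.integrable_comp_of_integrable (μ := P.prod P) e1).sub
        (measurePreserving_fst.integrable_comp_of_integrable (μ := P.prod P) e1)).congr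
        (ae_of_all _ fun z => ?_)
    simp [Finset.sum_sub_distrib]
  set G : (Fin n → α) × (Fin n → α) → ℝ := fun z =>
    T.sup' hT fun t => ∑ i, (h t (z.2 i) - h t (z.1 i)) with hG
  have intG : Integrable G (P.prod P) := integrable_finset_sup' hT intD
  have step1 : ∫ z, T.sup' hT (fun t => ∑ i, (∫ a, h t a ∂ν - h t (z i))) ∂P ≤
      ∫ z, G z ∂(P.prod P) := by
    rw [integral_prod _ intG]
    refine integral_mono_ae ?_ intG.integral_prod_left ?_
    · refine integrable_finset_sup' hT fun t ht => ?_
      simpa [sub_eq_add_neg] using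
        integrable_sum_comp_eval (n := n) (hh t ht) (fun _ => ∫ a, h t a ∂ν) (fun _ => -1)
    filter_upwards [intG.prod_right_ae] with z hz
    refine Finset.sup'_le _ _ fun t ht => ?_
    have e2 : Integrable (fun z' : Fin n → α => ∑ i, (h t (z' i) - h t (z i))) P := by
      simpa [sub_eq_add_neg, add_comm] using
        integrable_sum_comp_eval (n := n) (hh t ht) (fun i => - h t (z i)) (fun _ => 1)
    have e3 : ∫ z' : Fin n → α, ∑ i, (h t (z' i) - h t (z i)) ∂P =
        ∑ i, (∫ a, h t a ∂ν - h t (z i)) := by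
      have me := fun i => measurePreserving_eval (fun _ : Fin n => ν) i
      have e4 : ∀ i, Integrable (fun z' : Fin n → α => h t (z' i)) P := fun i =>
        (me i).integrable_comp_of_integrable (hh t ht)
      rw [integral_finsetSum Finset.univ (f := fun i (z' : Fin n → α) => h t (z' i) - h t (z i))
        fun i _ => (e4 i).sub (integrable_const _)]
      refine Finset.sum_congr rfl fun i _ => ?_
      rw [integral_sub (e4 i) (integrable_const _), integral_const]
      have e5 : ∫ z' : Fin n → α, h t (z' i) ∂P = ∫ a, h t a ∂ν := by
        conv_rhs => rw [← (me i).map_eq]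
        rw [integral_map (me i).measurable.aemeasurable]
        rw [(me i).map_eq]; exact (hh t ht).aestronglyMeasurable
      simp [e5]
    rw [← e3]
    exact integral_mono e2 hz fun z' => T.le_sup'
      (fun t => ∑ i, (h t (z' i) - h t (z i))) ht
  have step2 : ∀ ε : Fin n → Bool, ∫ z, G z ∂(P.prod P) ≤
      ∫ z, T.sup' hT (fun t => ∑ i, boolSign (ε i) * h t (z i)) ∂P +
      ∫ z, T.sup' hT (fun t => ∑ i, boolSign (!ε i) * h t (z i)) ∂P := by
    intro ε
    have msw : MeasurePreserving
        (fun (w : Fin n → α × α) i => if ε i then w i else (w i).swap) Q Q :=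
      measurePreserving_pi (fun _ => ν.prod ν) (fun _ => ν.prod ν)
        (f := fun i a => if ε i then a else a.swap) fun i => by
          cases ε i
          · simpa using Measure.measurePreserving_swap
          · exact MeasurePreserving.id _
    have mcomp := mpair.comp msw
    have e1 : ∫ z, G z ∂(P.prod P) = ∫ w, G ((MeasurableEquiv.arrowProdEquivProdArrow α α (Fin n))
        (fun i => if ε i then w i else (w i).swap)) ∂Q := by
      conv_lhs => rw [← mcomp.map_eq]
      rw [integral_map mcomp.measurable.aemeasurable]
      · rfl
      · rw [mcomp.map_eq]; exact intG.aestronglyMeasurable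
    have i1 : Integrable (fun w : Fin n → α × α =>
        T.sup' hT fun t => ∑ i, boolSign (!ε i) * h t (w i).1) Q :=
      m1.integrable_comp_of_integrable (intS fun i => boolSign (!ε i))
    have i2 : Integrable (fun w : Fin n → α × α =>
        T.sup' hT fun t => ∑ i, boolSign (ε i) * h t (w i).2) Q :=
      m2.integrable_comp_of_integrable (intS fun i => boolSign (ε i))
    have e3 : ∀ c : Fin n → ℝ, ∀ {F : (Fin n → α × α) → Fin n → α}, MeasurePreserving F Q P →
        ∫ w, T.sup' hT (fun t => ∑ i, c i * h t (F w i)) ∂Q =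
        ∫ z, T.sup' hT (fun t => ∑ i, c i * h t (z i)) ∂P := by
      intro c F hF
      conv_rhs => rw [← hF.map_eq]
      rw [integral_map hF.measurable.aemeasurable]
      rw [hF.map_eq]; exact (intS c).aestronglyMeasurable
    rw [e1, ← e3 _ m2, ← e3 _ m1, ← integral_add i2 i1]
    refine integral_mono (mcomp.integrable_comp_of_integrable intG) (i2.add i1) fun w => ?_
    refine Finset.sup'_le _ _ fun t ht => ?_
    have f1 := T.le_sup' (fun t => ∑ i, boolSign (ε i) * h t (w i).2) ht
    have f2 := T.le_sup' (fun t => ∑ i, boolSign (!ε i) * h t (w i).1) ht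
    refine le_trans (le_of_eq ?_) (add_le_add f1 f2)
    rw [← Finset.sum_add_distrib]
    refine Finset.sum_congr rfl fun i _ => ?_
    change h t (if ε i then w i else (w i).swap).2 - h t (if ε i then w i else (w i).swap).1 = _
    cases ε i <;> simp <;> ring
  have hflip : ∑ ε : Fin n → Bool, ∫ z, T.sup' hT (fun t => ∑ i, boolSign (!ε i) * h t (z i)) ∂P =
      ∑ ε : Fin n → Bool, ∫ z, T.sup' hT (fun t => ∑ i, boolSign (ε i) * h t (z i)) ∂P :=
    (Equiv.piCongrRight fun _ : Fin n => Equiv.boolNot).sum_comp fun ε =>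
      ∫ z, T.sup' hT (fun t => ∑ i, boolSign (ε i) * h t (z i)) ∂P
  have hsum := Finset.sum_le_sum fun ε (_ : ε ∈ (Finset.univ : Finset (Fin n → Bool))) => step2 ε
  rw [Finset.sum_add_distrib, hflip, Finset.sum_const, Finset.card_univ, Fintype.card_fun,
    Fintype.card_bool, Fintype.card_fin, nsmul_eq_mul] at hsum
  push_cast at hsum
  have : (0 : ℝ) < 2 ^ n := by positivity
  nlinarith [mul_le_mul_of_nonneg_left step1 this.le]

/-! ### The check loss -/

lemma rho_eq_max {τ : ℝ} (u : ℝ) : rho τ u = max (τ * u) ((τ - 1) * u) := by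
  unfold rho
  split_ifs with h
  · rw [max_eq_right (by nlinarith)]; ring
  · rw [max_eq_left (by nlinarith)]; ring

lemma abs_rho_sub_le {τ : ℝ} (h0 : 0 ≤ τ) (h1 : τ ≤ 1) (u v : ℝ) :
    |rho τ u - rho τ v| ≤ |u - v| := by
  rw [rho_eq_max, rho_eq_max]
  refine (abs_max_sub_max_le_max _ _ _ _).trans (max_le ?_ ?_)
  · rw [← mul_sub, abs_mul, abs_of_nonneg h0]
    exact mul_le_of_le_one_left (abs_nonneg _) h1
  · rw [← mul_sub, abs_mul]
    exact mul_le_of_le_one_left (abs_nonneg _) (abs_le.2 ⟨by linarith, by linarith⟩)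

lemma continuous_rho (τ : ℝ) : Continuous (rho τ) := by
  rw [show rho τ = fun u => max (τ * u) ((τ - 1) * u) from funext fun u => rho_eq_max u]
  fun_prop

/-- The increase of the check loss at the observation `z = (x, y)` when the coefficient vector
changes from `β` to `β + δ`. -/
noncomputable def excessLoss {d : ℕ} (τ : ℝ) (β δ : Fin d → ℝ) (z : (Fin d → ℝ) × ℝ) : ℝ :=
  rho τ (z.2 - z.1 ⬝ᵥ β - z.1 ⬝ᵥ δ) - rho τ (z.2 - z.1 ⬝ᵥ β)

lemma abs_excessLoss_sub_le {d : ℕ} {τ : ℝ} (h0 : 0 ≤ τ) (h1 : τ ≤ 1) (β δ δ' : Fin d → ℝ)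
    (z : (Fin d → ℝ) × ℝ) :
    |excessLoss τ β δ z - excessLoss τ β δ' z| ≤ |z.1 ⬝ᵥ δ - z.1 ⬝ᵥ δ'| := by
  rw [excessLoss, excessLoss, sub_sub_sub_cancel_right]
  refine (abs_rho_sub_le h0 h1 _ _).trans (le_of_eq ?_)
  rw [sub_sub_sub_cancel_left, abs_sub_comm]

lemma excessLoss_zero {d : ℕ} (τ : ℝ) (β : Fin d → ℝ) (z : (Fin d → ℝ) × ℝ) :
    excessLoss τ β 0 z = 0 := by
  simp [excessLoss]

lemma abs_excessLoss_le {d : ℕ} {τ : ℝ} (h0 : 0 ≤ τ) (h1 : τ ≤ 1) (β δ : Fin d → ℝ)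
    (z : (Fin d → ℝ) × ℝ) : |excessLoss τ β δ z| ≤ |z.1 ⬝ᵥ δ| := by
  simpa [excessLoss_zero] using abs_excessLoss_sub_le h0 h1 β δ 0 z

lemma abs_dotProduct_le {d : ℕ} {x δ : Fin d → ℝ} {C : ℝ} (hx : ∀ j, |x j| ≤ C) :
    |x ⬝ᵥ δ| ≤ C * ∑ j, |δ j| := by
  rw [dotProduct, Finset.mul_sum]
  refine (Finset.abs_sum_le_sum_abs _ _).trans (Finset.sum_le_sum fun j _ => ?_)
  rw [abs_mul]
  exact mul_le_mul_of_nonneg_right (hx j) (abs_nonneg _)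

lemma continuous_excessLoss {d : ℕ} (τ : ℝ) (β : Fin d → ℝ) :
    Continuous fun q : (Fin d → ℝ) × (Fin d → ℝ) × ℝ => excessLoss τ β q.1 q.2 := by
  have := continuous_rho τ
  unfold excessLoss
  simp only [dotProduct]
  fun_prop

lemma measurable_excessLoss {d : ℕ} (τ : ℝ) (β δ : Fin d → ℝ) :
    Measurable (excessLoss τ β δ) :=
  ((continuous_excessLoss τ β).comp (by fun_prop : Continuous fun z => (δ, z))).measurable

lemma integrable_excessLoss {d : ℕ} {ν : Measure ((Fin d → ℝ) × ℝ)} [IsProbabilityMeasure ν]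
    {τ : ℝ} (h0 : 0 ≤ τ) (h1 : τ ≤ 1) (β δ : Fin d → ℝ) {C : ℝ}
    (hν : ∀ᵐ z ∂ν, ∀ j, |z.1 j| ≤ C) : Integrable (excessLoss τ β δ) ν := by
  refine Integrable.of_bound (measurable_excessLoss τ β δ).aestronglyMeasurable
    (C * ∑ j, |δ j|) ?_
  filter_upwards [hν] with z hz
  exact (abs_excessLoss_le h0 h1 β δ z).trans (abs_dotProduct_le hz)

/-! ### Uniform deviations over an `ℓ¹` ball -/

/-- The expected maximal deviation over finitely many directions in an `ℓ¹` ball: contraction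
removes the check loss, and duality between `ℓ¹` and `ℓ^∞` leaves one Rademacher sum per
predictor. -/
lemma integral_sup'_excessLoss_le {n d : ℕ} (hn : 0 < n) [NeZero d]
    {ν : Measure ((Fin d → ℝ) × ℝ)} [IsProbabilityMeasure ν] {τ : ℝ} (h0 : 0 ≤ τ) (h1 : τ ≤ 1)
    (β : Fin d → ℝ) {C L : ℝ} (hC : 0 < C) (hL : 0 ≤ L) (hν : ∀ᵐ z ∂ν, ∀ j, |z.1 j| ≤ C)
    {T : Finset (Fin d → ℝ)} (hT : T.Nonempty) (hTL : ∀ δ ∈ T, ∑ j, |δ j| ≤ L) :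
    ∫ z, T.sup' hT (fun δ => ∑ i, (∫ a, excessLoss τ β δ a ∂ν - excessLoss τ β δ (z i)))
        ∂(Measure.pi fun _ : Fin n => ν) ≤
      2 * L * (C * Real.sqrt (2 * n * Real.log (2 * d))) := by
  set P : Measure (Fin n → (Fin d → ℝ) × ℝ) := Measure.pi fun _ : Fin n => ν with hP
  have hint := fun δ : Fin d → ℝ => integrable_excessLoss h0 h1 β δ hν
  have hsym := integral_sup'_deviation_le (n := n) hT fun δ _ => hint δ
  have hz : ∀ᵐ z ∂P, ∀ i j, |(z i).1 j| ≤ C := by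
    rw [ae_all_iff]
    exact fun i => (measurePreserving_eval (fun _ : Fin n => ν) i).quasiMeasurePreserving.ae hν
  have hbound : ∑ ε : Fin n → Bool,
      ∫ z, T.sup' hT (fun δ => ∑ i, boolSign (ε i) * excessLoss τ β δ (z i)) ∂P ≤
      L * (2 ^ n * (C * Real.sqrt (2 * n * Real.log (2 * d)))) := by
    have hi : ∀ ε : Fin n → Bool, Integrable (fun z : Fin n → (Fin d → ℝ) × ℝ =>
        T.sup' hT (fun δ => ∑ i, boolSign (ε i) * excessLoss τ β δ (z i))) P := fun ε =>
      integrable_finset_sup' hT fun δ _ => by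
        simpa using integrable_sum_comp_eval (hint δ) (fun _ => 0) fun i => boolSign (ε i)
    rw [← integral_finsetSum _ fun ε _ => hi ε]
    refine (integral_mono_ae (integrable_finsetSum _ fun ε _ => hi ε)
      (integrable_const (L * (2 ^ n * (C * Real.sqrt (2 * n * Real.log (2 * d)))))) ?_).trans
      (by simp)
    filter_upwards [hz] with z hz
    have hcon := sum_signs_sup'_contraction hT (fun _ => 0)
      (fun i δ => excessLoss τ β δ (z i)) (fun i δ => (z i).1 ⬝ᵥ δ)
      fun i δ _ δ' _ => abs_excessLoss_sub_le h0 h1 β δ δ' (z i)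
    simp only [zero_add] at hcon
    refine hcon.trans (le_trans ?_ (mul_le_mul_of_nonneg_left
      (sum_signs_sup'_abs_le hn (fun i j => (z i).1 j) hC hz) hL))
    rw [Finset.mul_sum]
    refine Finset.sum_le_sum fun ε _ => Finset.sup'_le _ _ fun δ hδ => ?_
    have e1 : ∑ i, boolSign (ε i) * ((z i).1 ⬝ᵥ δ) =
        (fun j => ∑ i, boolSign (ε i) * (z i).1 j) ⬝ᵥ δ := by
      simp only [dotProduct, Finset.mul_sum, Finset.sum_mul]
      rw [Finset.sum_comm]
      exact Finset.sum_congr rfl fun _ _ => Finset.sum_congr rfl fun _ _ => by ring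
    have hM : ∀ j, |∑ i, boolSign (ε i) * (z i).1 j| ≤ Finset.univ.sup' Finset.univ_nonempty
        (fun j => |∑ i, boolSign (ε i) * (z i).1 j|) := fun j =>
      Finset.le_sup' (fun j => |∑ i, boolSign (ε i) * (z i).1 j|) (Finset.mem_univ j)
    rw [e1]
    refine (le_abs_self _).trans ((abs_dotProduct_le hM).trans ?_)
    rw [mul_comm]
    exact mul_le_mul_of_nonneg_right (hTL δ hδ) ((abs_nonneg _).trans (hM 0))
  have h2 : (0 : ℝ) < 2 ^ n := by positivity
  refine le_of_mul_le_mul_left (hsym.trans ?_) h2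
  nlinarith

lemma measure_finset_deviation_le {n d : ℕ} (hn : 0 < n) [NeZero d]
    {ν : Measure ((Fin d → ℝ) × ℝ)} [IsProbabilityMeasure ν] {τ : ℝ} (h0 : 0 ≤ τ) (h1 : τ ≤ 1)
    (β : Fin d → ℝ) {C L : ℝ} (hC : 0 < C) (hL : 0 ≤ L) (hν : ∀ᵐ z ∂ν, ∀ j, |z.1 j| ≤ C)
    {T : Finset (Fin d → ℝ)} (hT0 : 0 ∈ T) (hTL : ∀ δ ∈ T, ∑ j, |δ j| ≤ L) {a : ℝ} (ha : 0 < a) :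
    (Measure.pi fun _ : Fin n => ν) {z | ∃ δ ∈ T,
        a < ∑ i, (∫ a, excessLoss τ β δ a ∂ν - excessLoss τ β δ (z i))} ≤
      ENNReal.ofReal (2 * L * (C * Real.sqrt (2 * n * Real.log (2 * d))) / a) := by
  have hT : T.Nonempty := ⟨0, hT0⟩
  set P : Measure (Fin n → (Fin d → ℝ) × ℝ) := Measure.pi fun _ : Fin n => ν with hP
  set F : (Fin n → (Fin d → ℝ) × ℝ) → ℝ := fun z => T.sup' hT
    (fun δ => ∑ i, (∫ a, excessLoss τ β δ a ∂ν - excessLoss τ β δ (z i))) with hF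
  have hFi : Integrable F P := integrable_finset_sup' hT fun δ _ => by
    simpa [sub_eq_add_neg] using integrable_sum_comp_eval (n := n)
      (integrable_excessLoss h0 h1 β δ hν) (fun _ => ∫ a, excessLoss τ β δ a ∂ν) (fun _ => -1)
  have hF0 : ∀ z, 0 ≤ F z := fun z => by
    refine le_trans (le_of_eq ?_) (Finset.le_sup' (fun δ => ∑ i, (∫ a, excessLoss τ β δ a ∂ν
      - excessLoss τ β δ (z i))) hT0)
    simp [excessLoss_zero]
  have hmarkov := mul_meas_ge_le_integral_of_nonneg (ae_of_all _ hF0) hFi a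
  have hle := hmarkov.trans (integral_sup'_excessLoss_le hn h0 h1 β hC hL hν hT hTL)
  refine (measure_mono (t := {z | a ≤ F z}) ?_).trans ?_
  · rintro z ⟨δ, hδ, hz⟩
    exact hz.le.trans (Finset.le_sup' (fun δ => ∑ i, (∫ a, excessLoss τ β δ a ∂ν
      - excessLoss τ β δ (z i))) hδ)
  · rw [← ofReal_measureReal]
    exact ENNReal.ofReal_le_ofReal ((le_div_iff₀' ha).2 hle)

/-- The uniform deviation bound over a whole `ℓ¹` ball, from finite subsets of a countable dense
set by continuity. -/
theorem measure_ball_deviation_le {n d : ℕ} (hn : 0 < n) [NeZero d]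
    {ν : Measure ((Fin d → ℝ) × ℝ)} [IsProbabilityMeasure ν] {τ : ℝ} (h0 : 0 ≤ τ) (h1 : τ ≤ 1)
    (β : Fin d → ℝ) {C L : ℝ} (hC : 0 < C) (hL : 0 ≤ L) (hν : ∀ᵐ z ∂ν, ∀ j, |z.1 j| ≤ C)
    {a : ℝ} (ha : 0 < a) :
    (Measure.pi fun _ : Fin n => ν) {z | ∃ δ : Fin d → ℝ, ∑ j, |δ j| ≤ L ∧
        a < ∑ i, (∫ a, excessLoss τ β δ a ∂ν - excessLoss τ β δ (z i))} ≤
      ENNReal.ofReal (2 * L * (C * Real.sqrt (2 * n * Real.log (2 * d))) / a) := by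
  let ball := {δ : Fin d → ℝ // ∑ j, |δ j| ≤ L}
  have : Nonempty ball := ⟨⟨0, by simpa using hL⟩⟩
  let f : ℕ → ball := TopologicalSpace.denseSeq ball
  classical
  let T : ℕ → Finset (Fin d → ℝ) := fun m => insert 0 ((Finset.range m).image fun i => (f i).1)
  have hTmono : Monotone T := fun m m' h =>
    Finset.insert_subset_insert _ (Finset.image_subset_image (Finset.range_mono h))
  let E : ℕ → Set (Fin n → (Fin d → ℝ) × ℝ) := fun m => {z | ∃ δ ∈ T m,
        a < ∑ i, (∫ a, excessLoss τ β δ a ∂ν - excessLoss τ β δ (z i))}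
  have hEmono : Monotone E := fun m m' h z ⟨δ, hδ, hz⟩ => ⟨δ, hTmono h hδ, hz⟩
  have hE : ∀ m, (Measure.pi fun _ : Fin n => ν) (E m) ≤
      ENNReal.ofReal (2 * L * (C * Real.sqrt (2 * n * Real.log (2 * d))) / a) := fun m => by
    refine measure_finset_deviation_le hn h0 h1 β hC hL hν (Finset.mem_insert_self _ _) ?_ ha
    intro δ hδ
    rcases Finset.mem_insert.1 hδ with rfl | hδ
    · simpa using hL
    · obtain ⟨i, -, rfl⟩ := Finset.mem_image.1 hδ
      exact (f i).2
  refine (measure_mono ?_).trans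
    (le_of_tendsto' (tendsto_measure_iUnion_atTop hEmono) hE)
  rintro z ⟨δ, hδ, hz⟩
  have hcont : Continuous fun δ : ball =>
      ∑ i, (∫ a, excessLoss τ β δ.1 a ∂ν - excessLoss τ β δ.1 (z i)) := by
    have c1 : ∀ z, Continuous fun δ : ball => excessLoss τ β δ.1 z := fun z =>
      (continuous_excessLoss τ β).comp (by fun_prop : Continuous fun δ : ball => (δ.1, z))
    refine continuous_finsetSum _ fun i _ => Continuous.sub ?_ (c1 _)
    refine continuous_of_dominated (bound := fun _ => C * L)
      (fun δ => (measurable_excessLoss τ β δ.1).aestronglyMeasurable) (fun δ => ?_)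
      (integrable_const _) (ae_of_all _ c1)
    filter_upwards [hν] with z hz
    exact (abs_excessLoss_le h0 h1 β δ.1 z).trans ((abs_dotProduct_le hz).trans
      (mul_le_mul_of_nonneg_left δ.2 hC.le))
  obtain ⟨m, hm⟩ := (TopologicalSpace.denseRange_denseSeq ball).exists_mem_open
    (isOpen_lt continuous_const hcont) ⟨⟨δ, hδ⟩, hz⟩
  exact Set.mem_iUnion.2 ⟨m + 1, (f m).1, Finset.mem_insert_of_mem
    (Finset.mem_image_of_mem _ (Finset.self_mem_range_succ m)), hm⟩

/-! ### Concentration of the score -/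

/-- Hoeffding's lemma for a centred Bernoulli variable, in explicit form. -/
lemma bernoulli_exp_le {τ : ℝ} (h0 : 0 ≤ τ) (h1 : τ ≤ 1) (θ : ℝ) :
    τ * Real.exp (θ * (τ - 1)) + (1 - τ) * Real.exp (θ * τ) ≤ Real.exp (θ ^ 2 / 8) := by
  let ν : Measure ℝ := ENNReal.ofReal τ • Measure.dirac (τ - 1)
    + ENNReal.ofReal (1 - τ) • Measure.dirac τ
  have hν : IsProbabilityMeasure ν := ⟨by
    simp [ν, ← ENNReal.ofReal_add h0 (sub_nonneg.2 h1)]⟩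
  have hint : ∀ f : ℝ → ℝ, ∫ t, f t ∂ν = τ * f (τ - 1) + (1 - τ) * f τ := fun f => by
    rw [integral_add_measure
      ((integrable_dirac (by simp)).smul_measure ENNReal.ofReal_ne_top)
      ((integrable_dirac (by simp)).smul_measure ENNReal.ofReal_ne_top),
      integral_smul_measure, integral_smul_measure, integral_dirac, integral_dirac,
      ENNReal.toReal_ofReal h0, ENNReal.toReal_ofReal (sub_nonneg.2 h1)]
    simp
  have hmem : ∀ᵐ t ∂ν, t ∈ Set.Icc (τ - 1) τ := by
    rw [ae_add_measure_iff]
    constructor <;> refine Measure.ae_smul_measure ?_ _ <;>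
      refine (ae_dirac_iff (p := fun t => t ∈ Set.Icc (τ - 1) τ) measurableSet_Icc).2 ⟨?_, ?_⟩ <;>
      linarith
  have hmgf := (hasSubgaussianMGF_of_mem_Icc_of_integral_eq_zero (X := fun t => t)
    aemeasurable_id hmem (by rw [hint]; ring)).mgf_le θ
  rw [mgf, hint] at hmgf
  refine hmgf.trans (le_of_eq ?_)
  congr 1
  simp
  ring

/-- If `A` has constant conditional probability `τ` given `X`, its indicator is uncorrelated with
every function of `X`. -/
lemma integral_mul_indicator_of_condProb {Ω E : Type*} [MeasurableSpace Ω] {mE : MeasurableSpace E}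
    {μ : Measure Ω} [IsProbabilityMeasure μ] {X : Ω → E} (hX : Measurable X) {A : Set Ω}
    (hA : MeasurableSet A) {τ : ℝ}
    (hτ : μ⟦A | mE.comap X⟧ =ᵐ[μ] fun _ => τ) {g : E → ℝ} (hg : Measurable g)
    (hgi : Integrable (fun ω => g (X ω)) μ) :
    Integrable (fun ω => g (X ω) * A.indicator (fun _ => 1) ω) μ ∧
    ∫ ω, g (X ω) * A.indicator (fun _ => 1) ω ∂μ = τ * ∫ ω, g (X ω) ∂μ := by
  have hi : Integrable (fun ω => g (X ω) * A.indicator (fun _ => (1 : ℝ)) ω) μ := by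
    refine hgi.mul_of_top_left ?_
    refine memLp_top_of_bound
      (measurable_const.indicator hA).aestronglyMeasurable 1 (ae_of_all _ fun ω => ?_)
    by_cases h : ω ∈ A <;> simp [h]
  refine ⟨hi, ?_⟩
  have hsm : StronglyMeasurable[mE.comap X] fun ω => g (X ω) :=
    (hg.comp (comap_measurable X)).stronglyMeasurable
  have h1 := condExp_mul_of_stronglyMeasurable_left hsm hi
    ((integrable_const (1 : ℝ)).indicator hA)
  rw [← integral_condExp hX.comap_le, ← integral_const_mul]
  refine integral_congr_ae ?_
  filter_upwards [h1, hτ] with ω h2 h3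
  refine h2.trans ?_
  rw [Pi.mul_apply, h3, mul_comm]

/-- The coordinate `j` of the score of the check loss at the observation `z = (x, y)`. -/
noncomputable def score {d : ℕ} (τ : ℝ) (β : Fin d → ℝ) (j : Fin d) (z : (Fin d → ℝ) × ℝ) : ℝ :=
  z.1 j * (τ - if z.2 - z.1 ⬝ᵥ β < 0 then 1 else 0)

lemma measurable_dotProduct_const {d : ℕ} (β : Fin d → ℝ) :
    Measurable fun x : Fin d → ℝ => x ⬝ᵥ β := by
  unfold dotProduct; fun_prop

lemma measurable_score {d : ℕ} (τ : ℝ) (β : Fin d → ℝ) (j : Fin d) :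
    Measurable (score τ β j) := by
  have h := (measurable_dotProduct_const β).comp
    (measurable_fst : Measurable (Prod.fst : (Fin d → ℝ) × ℝ → _))
  refine ((measurable_pi_apply j).comp measurable_fst).mul (measurable_const.sub ?_)
  exact Measurable.ite (measurableSet_lt (measurable_snd.sub h) measurable_const)
    measurable_const measurable_const

/-- Conditionally on the predictors the score is a centred Bernoulli variable times a number below
`C`, so that its sub-Gaussian parameter is `C ^ 2 / 4`. Hoeffding's lemma for the interval
`[-C, C]` would only give `C ^ 2`, which is too large for a union bound over all predictors. -/
lemma hasSubgaussianMGF_score {Ω : Type*} [MeasurableSpace Ω] {μ : Measure Ω}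
    [IsProbabilityMeasure μ] {d : ℕ} {X : Ω → Fin d → ℝ} {Y : Ω → ℝ} (hX : Measurable X)
    (hY : Measurable Y) {τ : ℝ} (h0 : 0 ≤ τ) (h1 : τ ≤ 1) {β : Fin d → ℝ}
    (hτ : μ⟦{ω | Y ω - X ω ⬝ᵥ β < 0} | MeasurableSpace.comap X inferInstance⟧ =ᵐ[μ] fun _ => τ)
    (C : NNReal) (j : Fin d) (hC : ∀ᵐ ω ∂μ, |X ω j| ≤ C) :
    HasSubgaussianMGF (fun ω => score τ β j (X ω, Y ω)) (C ^ 2 / 4) μ := by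
  set A : Set Ω := {ω | Y ω - X ω ⬝ᵥ β < 0} with hAdef
  have hA : MeasurableSet A :=
    measurableSet_lt (hY.sub ((measurable_dotProduct_const β).comp hX)) measurable_const
  have hexp : ∀ c : ℝ, Integrable (fun ω => Real.exp (c * X ω j)) μ := fun c => by
    refine Integrable.of_bound (C := Real.exp (|c| * C))
      (by fun_prop : Measurable fun ω => Real.exp (c * X ω j)).aestronglyMeasurable ?_
    filter_upwards [hC] with ω hω
    rw [Real.norm_eq_abs, abs_of_pos (Real.exp_pos _), Real.exp_le_exp]
    refine (le_abs_self _).trans ?_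
    rw [abs_mul]
    exact mul_le_mul_of_nonneg_left hω (abs_nonneg _)
  have hg : ∀ c : ℝ, Measurable fun x : Fin d → ℝ => Real.exp (c * x j) := fun c => by fun_prop
  have key : ∀ t : ℝ, ∀ ω, Real.exp (t * score τ β j (X ω, Y ω)) =
      Real.exp (t * (τ - 1) * X ω j) * A.indicator (fun _ => 1) ω + (Real.exp (t * τ * X ω j)
        - Real.exp (t * τ * X ω j) * A.indicator (fun _ => 1) ω) := by
    intro t ω
    by_cases h : ω ∈ A
    · have h' : Y ω - X ω ⬝ᵥ β < 0 := h
      simp only [score, h', if_true, Set.indicator_of_mem h]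
      ring_nf
    · have h' : ¬ Y ω - X ω ⬝ᵥ β < 0 := h
      simp only [score, h', if_false, Set.indicator_of_notMem h]
      ring_nf
  have hind := fun c : ℝ => integral_mul_indicator_of_condProb hX hA hτ (hg c) (hexp c)
  refine ⟨fun t => ?_, fun t => ?_⟩
  · simp_rw [key t]
    exact (hind _).1.add ((hexp _).sub (hind _).1)
  · rw [mgf]
    simp_rw [key t]
    rw [integral_add (hind (t * (τ - 1))).1
        (g := fun ω => Real.exp (t * τ * X ω j) - Real.exp (t * τ * X ω j)
          * A.indicator (fun _ => 1) ω) ((hexp _).sub (hind _).1),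
      integral_sub (hexp _) (hind _).1,
      (hind _).2, (hind _).2]
    have e1 : τ * ∫ ω, Real.exp (t * (τ - 1) * X ω j) ∂μ + (∫ ω, Real.exp (t * τ * X ω j) ∂μ -
        τ * ∫ ω, Real.exp (t * τ * X ω j) ∂μ) = ∫ ω, (τ * Real.exp (t * X ω j * (τ - 1)) +
          (1 - τ) * Real.exp (t * X ω j * τ)) ∂μ := by
      have e2 : ∀ ω, t * X ω j * (τ - 1) = t * (τ - 1) * X ω j := fun ω => by ring
      have e3 : ∀ ω, t * X ω j * τ = t * τ * X ω j := fun ω => by ring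
      simp_rw [e2, e3]
      rw [integral_add ((hexp _).const_mul _) ((hexp _).const_mul _), integral_const_mul,
        integral_const_mul]
      ring
    rw [e1]
    refine (integral_mono_of_nonneg (ae_of_all _ fun ω => ?_) (integrable_const
      (Real.exp (((C ^ 2 / 4 : NNReal) : ℝ) * t ^ 2 / 2))) ?_).trans (by simp)
    · have : 0 ≤ 1 - τ := sub_nonneg.2 h1
      positivity
    · filter_upwards [hC] with ω hω
      refine (bernoulli_exp_le h0 h1 (t * X ω j)).trans (Real.exp_le_exp.2 ?_)
      have : X ω j ^ 2 ≤ (C : ℝ) ^ 2 := sq_le_sq' (abs_le.1 hω).1 (abs_le.1 hω).2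
      push_cast
      nlinarith [sq_nonneg t]

/-- Two-sided Hoeffding bound for a coordinate of the empirical score. -/
lemma measure_score_ge_le {Ω : Type*} [MeasurableSpace Ω] {μ : Measure Ω}
    [IsProbabilityMeasure μ] {n d : ℕ} {X : Fin n → Ω → Fin d → ℝ} {Y : Fin n → Ω → ℝ}
    (hX : ∀ i, Measurable (X i)) (hY : ∀ i, Measurable (Y i))
    (hind : iIndepFun (fun i ω => (X i ω, Y i ω)) μ) {τ : ℝ} (h0 : 0 ≤ τ) (h1 : τ ≤ 1)
    {β : Fin d → ℝ} (hτ : ∀ i, μ⟦{ω | Y i ω - X i ω ⬝ᵥ β < 0} |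
      MeasurableSpace.comap (X i) inferInstance⟧ =ᵐ[μ] fun _ => τ)
    {C : ℝ} (hC0 : 0 ≤ C) (j : Fin d) (hC : ∀ i, ∀ᵐ ω ∂μ, |X i ω j| ≤ C) {a : ℝ} (ha : 0 ≤ a) :
    μ {ω | a ≤ |∑ i, score τ β j (X i ω, Y i ω)|} ≤
      ENNReal.ofReal (2 * Real.exp (-(2 * a ^ 2 / (n * C ^ 2)))) := by
  lift C to NNReal using hC0
  have hs := HasSubgaussianMGF.sum_of_iIndepFun (s := Finset.univ)
    (hind.comp (fun _ => score τ β j) fun _ => measurable_score τ β j)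
    (c := fun _ => C ^ 2 / 4)
    fun i _ => hasSubgaussianMGF_score (hX i) (hY i) h0 h1 (hτ i) C j (hC i)
  have e1 := hs.measure_ge_le ha
  have e2 := hs.neg.measure_ge_le ha
  have e3 : Real.exp (-a ^ 2 / (2 * ((∑ _i : Fin n, C ^ 2 / 4 : NNReal) : ℝ))) =
      Real.exp (-(2 * a ^ 2 / (n * (C : ℝ) ^ 2))) := by
    congr 1
    simp only [Finset.sum_const, Finset.card_univ, Fintype.card_fin, nsmul_eq_mul]
    push_cast
    rw [show 2 * ((n : ℝ) * ((C : ℝ) ^ 2 / 4)) = (n * (C : ℝ) ^ 2) / 2 by ring, div_div_eq_mul_div]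
    ring
  rw [e3] at e1 e2
  refine (measure_mono (t := {ω | a ≤ ∑ i, score τ β j (X i ω, Y i ω)} ∪
    {ω | a ≤ -∑ i, score τ β j (X i ω, Y i ω)}) fun ω hω => ?_).trans
    ((measure_union_le _ _).trans ?_)
  · exact le_abs.1 (Set.mem_ofPred.1 hω)
  · rw [two_mul, ENNReal.ofReal_add (Real.exp_pos _).le (Real.exp_pos _).le,
      ← ofReal_measureReal, ← ofReal_measureReal]
    exact add_le_add (ENNReal.ofReal_le_ofReal e1) (ENNReal.ofReal_le_ofReal e2)

/-! ### Curvature of the expected loss -/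

/-- The remainder in Knight's identity: the increase of the check loss from `u` to `u - v`, minus
its linearization. -/
noncomputable def checkRemainder (τ u v : ℝ) : ℝ :=
  rho τ (u - v) - rho τ u + v * (τ - if u < 0 then 1 else 0)

lemma checkRemainder_of_nonneg (τ u : ℝ) {v : ℝ} (hv : 0 ≤ v) :
    checkRemainder τ u v = (Set.Ico 0 v).indicator (fun u => v - u) u := by
  unfold checkRemainder rho
  simp only [Set.indicator_apply, Set.mem_Ico]
  split_ifs <;> grind

lemma checkRemainder_of_nonpos (τ u : ℝ) {v : ℝ} (hv : v ≤ 0) :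
    checkRemainder τ u v = (Set.Ico v 0).indicator (fun u => u - v) u := by
  unfold checkRemainder rho
  simp only [Set.indicator_apply, Set.mem_Ico]
  split_ifs <;> grind

lemma checkRemainder_nonneg (τ u v : ℝ) : 0 ≤ checkRemainder τ u v := by
  rcases le_total 0 v with hv | hv
  · rw [checkRemainder_of_nonneg τ u hv]
    exact Set.indicator_nonneg (fun u hu => sub_nonneg.2 hu.2.le) _
  · rw [checkRemainder_of_nonpos τ u hv]
    exact Set.indicator_nonneg (fun u hu => sub_nonneg.2 hu.1) _

lemma checkRemainder_le_abs (τ u v : ℝ) : checkRemainder τ u v ≤ |v| := by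
  rcases le_total 0 v with hv | hv
  · rw [checkRemainder_of_nonneg τ u hv, abs_of_nonneg hv]
    exact Set.indicator_le' (f := fun u => v - u) (g := fun _ => v)
      (fun u hu => by linarith [hu.1]) (fun _ _ => hv) u
  · rw [checkRemainder_of_nonpos τ u hv, abs_of_nonpos hv]
    exact Set.indicator_le' (f := fun u => u - v) (g := fun _ => -v)
      (fun u hu => by linarith [hu.2]) (fun _ _ => neg_nonneg.2 hv) u

/-- A function that is at least `c₁` at `0` and has derivative at most `c₂` is at least
`c₁ - c₂ |u|`; integrating this bound against the remainder gives the quadratic lower bound with a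
cubic error. -/
lemma le_integral_mul_checkRemainder {g : ℝ → ℝ} (hg : Differentiable ℝ g) {c₁ c₂ : ℝ}
    (hg0 : c₁ ≤ g 0) (hg' : ∀ t, |deriv g t| ≤ c₂) (τ v : ℝ) :
    c₁ / 2 * v ^ 2 - c₂ / 6 * |v| ^ 3 ≤ ∫ u, g u * checkRemainder τ u v := by
  have hlow : ∀ u, c₁ - c₂ * |u| ≤ g u := fun u => by
    have h := Convex.norm_image_sub_le_of_norm_deriv_le (f := g) (s := Set.univ) (x := 0) (y := u)
      (fun t _ => hg t) (fun t _ => hg' t) convex_univ trivial trivial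
    rw [sub_zero, Real.norm_eq_abs, Real.norm_eq_abs] at h
    linarith [(abs_le.1 h).1]
  rcases le_total 0 v with hv | hv
  · have e1 : ∫ u, g u * checkRemainder τ u v = ∫ u in (0)..v, g u * (v - u) := by
      rw [intervalIntegral.integral_of_le hv, ← integral_Ico_eq_integral_Ioc,
        ← integral_indicator measurableSet_Ico]
      refine integral_congr_ae (ae_of_all _ fun u => ?_)
      simp only [checkRemainder_of_nonneg τ u hv, Set.indicator_apply, mul_ite, mul_zero]
    have e2 : ∫ u in (0)..v, (c₁ - c₂ * u) * (v - u) = c₁ / 2 * v ^ 2 - c₂ / 6 * v ^ 3 := by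
      rw [intervalIntegral.integral_eq_sub_of_hasDerivAt
        (f := fun u => c₁ * v * u - (c₁ + c₂ * v) * u ^ 2 / 2 + c₂ * u ^ 3 / 3)]
      · ring
      · intro u _
        refine ((((hasDerivAt_id' u).const_mul (c₁ * v)).fun_sub
          (((hasDerivAt_pow 2 u).const_mul (c₁ + c₂ * v)).div_const 2)).fun_add
          (((hasDerivAt_pow 3 u).const_mul c₂).div_const 3)).congr_deriv ?_
        push_cast
        ring
      · exact Continuous.intervalIntegrable (by fun_prop) _ _
    rw [e1, abs_of_nonneg hv, ← e2]
    refine intervalIntegral.integral_mono_on hv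
      (Continuous.intervalIntegrable (by fun_prop) _ _)
      ((hg.continuous.mul (by fun_prop)).intervalIntegrable _ _) fun u hu => ?_
    refine mul_le_mul_of_nonneg_right ?_ (sub_nonneg.2 hu.2)
    simpa [abs_of_nonneg hu.1] using hlow u
  · have e1 : ∫ u, g u * checkRemainder τ u v = ∫ u in v..0, g u * (u - v) := by
      rw [intervalIntegral.integral_of_le hv, ← integral_Ico_eq_integral_Ioc,
        ← integral_indicator measurableSet_Ico]
      refine integral_congr_ae (ae_of_all _ fun u => ?_)
      simp only [checkRemainder_of_nonpos τ u hv, Set.indicator_apply, mul_ite, mul_zero]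
    have e2 : ∫ u in v..0, (c₁ + c₂ * u) * (u - v) = c₁ / 2 * v ^ 2 - c₂ / 6 * (-v) ^ 3 := by
      rw [intervalIntegral.integral_eq_sub_of_hasDerivAt
        (f := fun u => -(c₁ * v * u) + (c₁ - c₂ * v) * u ^ 2 / 2 + c₂ * u ^ 3 / 3)]
      · ring
      · intro u _
        refine (((((hasDerivAt_id' u).const_mul (c₁ * v)).fun_neg).fun_add
          (((hasDerivAt_pow 2 u).const_mul (c₁ - c₂ * v)).div_const 2)).fun_add
          (((hasDerivAt_pow 3 u).const_mul c₂).div_const 3)).congr_deriv ?_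
        push_cast
        ring
      · exact Continuous.intervalIntegrable (by fun_prop) _ _
    rw [e1, abs_of_nonpos hv, ← e2]
    refine intervalIntegral.integral_mono_on hv
      (Continuous.intervalIntegrable (by fun_prop) _ _)
      ((hg.continuous.mul (by fun_prop)).intervalIntegrable _ _) fun u hu => ?_
    refine mul_le_mul_of_nonneg_right ?_ (sub_nonneg.2 hu.1)
    simpa [abs_of_nonpos hu.2] using hlow u

lemma le_integral_checkRemainder_withDensity {f : ℝ → ℝ} (hf0 : ∀ t, 0 ≤ f t)
    (hf : Differentiable ℝ f) {c₁ c₂ m : ℝ} (hm : c₁ ≤ f m) (hf' : ∀ t, |deriv f t| ≤ c₂)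
    (τ v : ℝ) :
    c₁ / 2 * v ^ 2 - c₂ / 6 * |v| ^ 3 ≤ ∫ t, checkRemainder τ (t - m) v
      ∂(volume.withDensity fun t => ENNReal.ofReal (f t)) := by
  rw [integral_withDensity_eq_integral_toReal_smul hf.continuous.measurable.ennreal_ofReal
    (ae_of_all _ fun _ => ENNReal.ofReal_lt_top)]
  have h := le_integral_mul_checkRemainder (g := fun u => f (u + m))
    (hf.comp (differentiable_id.add_const m)) (c₁ := c₁) (c₂ := c₂) (by simpa using hm)
    (fun t => by rw [deriv_comp_add_const]; exact hf' _) τ v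
  refine h.trans (le_of_eq ?_)
  rw [← integral_add_right_eq_self (fun t => (ENNReal.ofReal (f t)).toReal •
    checkRemainder τ (t - m) v) m]
  refine integral_congr_ae (ae_of_all _ fun u => ?_)
  simp [ENNReal.toReal_ofReal (hf0 _)]

/-- The expected increase of the check loss away from the true conditional quantile: its linear
part vanishes, and the remainder is bounded below conditionally on the predictors. -/
theorem le_integral_excessLoss {Ω : Type*} [MeasurableSpace Ω] {μ : Measure Ω}
    [IsProbabilityMeasure μ] {d : ℕ} {X : Ω → Fin d → ℝ} {Y : Ω → ℝ} (hX : Measurable X)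
    (hY : Measurable Y) {τ : ℝ} {β : Fin d → ℝ}
    (hτ : μ⟦{ω | Y ω - X ω ⬝ᵥ β < 0} | MeasurableSpace.comap X inferInstance⟧ =ᵐ[μ] fun _ => τ)
    {C : ℝ} (hC : ∀ᵐ ω ∂μ, ∀ j, |X ω j| ≤ C) {c₁ c₂ : ℝ}
    (hdens : ∀ᵐ ω ∂μ, ∃ f : ℝ → ℝ, (∀ t, 0 ≤ f t) ∧
      condDistrib Y X μ (X ω) = volume.withDensity (fun t => ENNReal.ofReal (f t)) ∧
      Differentiable ℝ f ∧ (∀ t, |deriv f t| ≤ c₂) ∧ c₁ ≤ f (X ω ⬝ᵥ β)) (δ : Fin d → ℝ) :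
    c₁ / 2 * ∫ ω, (X ω ⬝ᵥ δ) ^ 2 ∂μ - c₂ / 6 * ∫ ω, |X ω ⬝ᵥ δ| ^ 3 ∂μ ≤
      ∫ ω, excessLoss τ β δ (X ω, Y ω) ∂μ := by
  set A : Set Ω := {ω | Y ω - X ω ⬝ᵥ β < 0} with hAdef
  have hmd := fun b : Fin d → ℝ => measurable_dotProduct_const b
  have hA : MeasurableSet A := measurableSet_lt (hY.sub ((hmd β).comp hX)) measurable_const
  have hb : ∀ᵐ ω ∂μ, |X ω ⬝ᵥ δ| ≤ C * ∑ j, |δ j| := by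
    filter_upwards [hC] with ω hω using abs_dotProduct_le hω
  have hv : Integrable (fun ω => X ω ⬝ᵥ δ) μ :=
    Integrable.of_bound ((hmd δ).comp hX).aestronglyMeasurable _ hb
  have hv2 : Integrable (fun ω => (X ω ⬝ᵥ δ) ^ 2) μ := by
    refine Integrable.of_bound (((hmd δ).comp hX).pow_const 2).aestronglyMeasurable
      ((C * ∑ j, |δ j|) ^ 2) ?_
    filter_upwards [hb] with ω hω
    rw [norm_pow, Real.norm_eq_abs]
    gcongr
  have hv3 : Integrable (fun ω => |X ω ⬝ᵥ δ| ^ 3) μ := by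
    refine Integrable.of_bound
      (((hmd δ).comp hX).abs.pow_const 3).aestronglyMeasurable ((C * ∑ j, |δ j|) ^ 3) ?_
    filter_upwards [hb] with ω hω
    rw [norm_pow, Real.norm_eq_abs, abs_abs]
    gcongr
  set R : (Fin d → ℝ) × ℝ → ℝ := fun z => checkRemainder τ (z.2 - z.1 ⬝ᵥ β) (z.1 ⬝ᵥ δ) with hR
  have hRm : Measurable R := by
    have h1 := (hmd β).comp (measurable_fst : Measurable (Prod.fst : (Fin d → ℝ) × ℝ → _))
    have h2 := (hmd δ).comp (measurable_fst : Measurable (Prod.fst : (Fin d → ℝ) × ℝ → _))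
    refine (measurable_excessLoss τ β δ).add (h2.mul (measurable_const.sub ?_))
    exact Measurable.ite (measurableSet_lt (measurable_snd.sub h1) measurable_const)
      measurable_const measurable_const
  have hRi : Integrable (fun ω => R (X ω, Y ω)) μ := by
    refine Integrable.of_bound (hRm.comp (hX.prodMk hY)).aestronglyMeasurable
      (C * ∑ j, |δ j|) ?_
    filter_upwards [hb] with ω hω
    rw [Real.norm_eq_abs, abs_of_nonneg (checkRemainder_nonneg _ _ _)]
    exact (checkRemainder_le_abs _ _ _).trans hω
  have hRi' : Integrable R (μ.map fun ω => (X ω, Y ω)) :=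
    (integrable_map_measure hRm.aestronglyMeasurable (hX.prodMk hY).aemeasurable).2 hRi
  have hlin := integral_mul_indicator_of_condProb hX hA hτ (hmd δ) hv
  have e1 : ∫ ω, excessLoss τ β δ (X ω, Y ω) ∂μ = ∫ ω, R (X ω, Y ω) ∂μ := by
    have e2 : ∀ ω, excessLoss τ β δ (X ω, Y ω) = R (X ω, Y ω) -
        (τ * (X ω ⬝ᵥ δ) - X ω ⬝ᵥ δ * A.indicator (fun _ => 1) ω) := fun ω => by
      simp only [hR, checkRemainder, excessLoss, Set.indicator_apply, hAdef, Set.mem_ofPred_eq]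
      ring
    simp_rw [e2]
    rw [integral_sub (g := fun ω => τ * (X ω ⬝ᵥ δ) - X ω ⬝ᵥ δ * A.indicator (fun _ => 1) ω) hRi
      ((hv.const_mul τ).sub hlin.1), integral_sub (hv.const_mul τ) hlin.1,
      hlin.2, integral_const_mul, sub_self, sub_zero]
  have e3 : ∫ ω, R (X ω, Y ω) ∂μ = ∫ ω, ∫ y, R (X ω, y) ∂(condDistrib Y X μ (X ω)) ∂μ := by
    rw [← integral_condExp hX.comap_le]
    exact integral_congr_ae
      (condExp_prod_ae_eq_integral_condDistrib' hX hY.aemeasurable hRi')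
  rw [e1, e3, ← integral_const_mul, ← integral_const_mul,
    ← integral_sub (hv2.const_mul _) (hv3.const_mul _)]
  refine integral_mono_ae ((hv2.const_mul _).sub (hv3.const_mul _))
    (hRi'.integral_condDistrib hX.aemeasurable hY.aemeasurable) ?_
  filter_upwards [hdens] with ω hω
  obtain ⟨f, hf0, hf1, hf2, hf3, hf4⟩ := hω
  rw [hf1]
  exact le_integral_checkRemainder_withDensity hf0 hf2 hf4 hf3 τ _

/-! ### Group norms and the cone -/

lemma linPred_eq_dotProduct {K p : ℕ} (x : Fin (p + 1) → ℝ) (β : Coef K p) (k : Fin K) :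
    linPred x β k = x ⬝ᵥ (block β k).ofLp := rfl

lemma group_add {K p : ℕ} (β Δ : Coef K p) (j : Fin (p + 1)) :
    group (β + Δ) j = group β j + group Δ j := by ext; simp [group]

lemma group_smul {K p : ℕ} (t : ℝ) (Δ : Coef K p) (j : Fin (p + 1)) :
    group (t • Δ) j = t • group Δ j := by ext; simp [group]

lemma sum_sq_norm_group {K p : ℕ} (Δ : Coef K p) : ∑ j, ‖group Δ j‖ ^ 2 = ‖Δ‖ ^ 2 := by
  simp only [EuclideanSpace.norm_sq_eq, Fintype.sum_prod_type, group]
  exact Finset.sum_comm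

lemma sum_sq_norm_block {K p : ℕ} (Δ : Coef K p) : ∑ k, ‖block Δ k‖ ^ 2 = ‖Δ‖ ^ 2 := by
  simp only [EuclideanSpace.norm_sq_eq, Fintype.sum_prod_type, block]

lemma norm_block_le {K p : ℕ} (Δ : Coef K p) (k : Fin K) : ‖block Δ k‖ ≤ ‖Δ‖ := by
  refine le_of_sq_le_sq ?_ (norm_nonneg _)
  rw [← sum_sq_norm_block]
  exact Finset.single_le_sum (f := fun k => ‖block Δ k‖ ^ 2) (fun _ _ => sq_nonneg _)
    (Finset.mem_univ k)

lemma sum_abs_le_sqrt_mul_norm_group {K p : ℕ} (Δ : Coef K p) (j : Fin (p + 1)) :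
    ∑ k, |Δ (k, j)| ≤ Real.sqrt K * ‖group Δ j‖ := by
  have h := sq_sum_le_card_mul_sum_sq (s := (Finset.univ : Finset (Fin K)))
    (f := fun k => |Δ (k, j)|)
  rw [EuclideanSpace.norm_eq, ← Real.sqrt_mul (Nat.cast_nonneg K)]
  refine Real.le_sqrt_of_sq_le (h.trans (le_of_eq ?_))
  simp [group]

lemma sum_abs_block_le {K p : ℕ} (Δ : Coef K p) (k : Fin K) :
    ∑ j, |(block Δ k).ofLp j| ≤ ∑ j, ‖group Δ j‖ :=
  Finset.sum_le_sum fun j _ => PiLp.norm_apply_le (group Δ j) k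

lemma sum_norm_group_activeSetBar_le {K p : ℕ} (βstar Δ : Coef K p) :
    ∑ j ∈ activeSetBar βstar, ‖group Δ j‖ ≤
      Real.sqrt ((activeSet βstar).card + 1) * ‖Δ‖ := by
  have h := sq_sum_le_card_mul_sum_sq (s := activeSetBar βstar) (f := fun j => ‖group Δ j‖)
  have h1 : ((activeSetBar βstar).card : ℝ) ≤ (activeSet βstar).card + 1 := by
    exact_mod_cast Finset.card_insert_le _ _
  have h2 : ∑ j ∈ activeSetBar βstar, ‖group Δ j‖ ^ 2 ≤ ‖Δ‖ ^ 2 := by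
    rw [← sum_sq_norm_group]
    exact Finset.sum_le_sum_of_subset_of_nonneg (Finset.subset_univ _) fun _ _ _ => sq_nonneg _
  rw [← Real.sqrt_sq (norm_nonneg Δ), ← Real.sqrt_mul (by positivity)]
  exact Real.le_sqrt_of_sq_le (h.trans (mul_le_mul h1 h2
    (Finset.sum_nonneg fun _ _ => sq_nonneg _) (by positivity)))

lemma sum_norm_group_le_of_mem_cone {K p : ℕ} {βstar Δ : Coef K p} (hΔ : Δ ∈ cone βstar) :
    ∑ j, ‖group Δ j‖ ≤ 4 * (Real.sqrt ((activeSet βstar).card + 1) * ‖Δ‖) := by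
  have h : ∑ j ∈ (activeSetBar βstar)ᶜ, ‖group Δ j‖ ≤
    3 * ∑ j ∈ activeSetBar βstar, ‖group Δ j‖ := hΔ
  have h1 := sum_norm_group_activeSetBar_le βstar Δ
  rw [← Finset.sum_add_sum_compl (activeSetBar βstar)]
  linarith

lemma smul_mem_cone {K p : ℕ} {βstar Δ : Coef K p} (hΔ : Δ ∈ cone βstar) {t : ℝ} (ht : 0 ≤ t) :
    t • Δ ∈ cone βstar := by
  have h : ∑ j ∈ (activeSetBar βstar)ᶜ, ‖group Δ j‖ ≤
    3 * ∑ j ∈ activeSetBar βstar, ‖group Δ j‖ := hΔ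
  change ∑ j ∈ (activeSetBar βstar)ᶜ, ‖group (t • Δ) j‖ ≤
    3 * ∑ j ∈ activeSetBar βstar, ‖group (t • Δ) j‖
  simp only [group_smul, norm_smul, Real.norm_of_nonneg ht, ← Finset.mul_sum]
  nlinarith

/-- Decomposability of the penalty: inactive groups contribute their full norm, active ones lose
at most theirs. -/
lemma penalty_sub_ge {K p : ℕ} (βstar Δ : Coef K p) :
    ∑ j ∈ (activeSetBar βstar)ᶜ, ‖group Δ j‖ - ∑ j ∈ activeSetBar βstar, ‖group Δ j‖ ≤
      ∑ j : Fin p, ‖group (βstar + Δ) j.succ‖ - ∑ j : Fin p, ‖group βstar j.succ‖ := by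
  classical
  let f : Fin (p + 1) → ℝ := fun j =>
    if j = 0 then 0 else ‖group (βstar + Δ) j‖ - ‖group βstar j‖
  have h1 : ∑ j : Fin p, ‖group (βstar + Δ) j.succ‖ - ∑ j : Fin p, ‖group βstar j.succ‖ =
      ∑ j, f j := by
    rw [Fin.sum_univ_succ]
    simp [f, Fin.succ_ne_zero, Finset.sum_sub_distrib]
  rw [h1, ← Finset.sum_compl_add_sum (activeSetBar βstar), sub_eq_add_neg,
    ← Finset.sum_neg_distrib]
  refine add_le_add (Finset.sum_le_sum fun j hj => ?_) (Finset.sum_le_sum fun j _ => ?_)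
  · rw [Finset.mem_compl, activeSetBar, Finset.mem_insert, activeSet, Finset.mem_filter] at hj
    push Not at hj
    have h0 : group βstar j = 0 := norm_eq_zero.1 (hj.2 (Finset.mem_univ _) hj.1)
    simp [f, hj.1, group_add, h0]
  · by_cases hj : j = 0
    · simp [f, hj]
    · simp only [f, hj, if_false, group_add]
      have := norm_sub_le (group βstar j + group Δ j) (group Δ j)
      rw [add_sub_cancel_right] at this
      linarith

/-! ### The estimator on the good event -/

lemma objective_add_sub {n K p : ℕ} (τ : Fin K → ℝ) (lam : ℝ) (x : Fin n → Fin (p + 1) → ℝ)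
    (y : Fin n → ℝ) (βstar Δ : Coef K p) :
    objective τ lam x y (βstar + Δ) - objective τ lam x y βstar =
      1 / (n : ℝ) * (∑ k, ∑ i, excessLoss (τ k) (block βstar k).ofLp (block Δ k).ofLp (x i, y i))
      + lam * (∑ j : Fin p, ‖group (βstar + Δ) j.succ‖ - ∑ j : Fin p, ‖group βstar j.succ‖) := by
  have h : ∀ k i, excessLoss (τ k) (block βstar k).ofLp (block Δ k).ofLp (x i, y i) =
      rho (τ k) (y i - linPred (x i) (βstar + Δ) k) - rho (τ k) (y i - linPred (x i) βstar k) := by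
    intro k i
    have : linPred (x i) (βstar + Δ) k = x i ⬝ᵥ (block βstar k).ofLp + x i ⬝ᵥ (block Δ k).ofLp := by
      rw [← dotProduct_add]; rfl
    rw [excessLoss, this, linPred_eq_dotProduct, sub_sub]
  simp only [h, Finset.sum_sub_distrib, objective]
  ring

/-- By convexity, if `β + Δ` is at least as good as `β`, so is every point between them. -/
lemma objective_segment_le {n K p : ℕ} (τ : Fin K → ℝ) {lam : ℝ} (hlam : 0 ≤ lam)
    (x : Fin n → Fin (p + 1) → ℝ) (y : Fin n → ℝ) {β Δ : Coef K p}
    (h : objective τ lam x y (β + Δ) ≤ objective τ lam x y β) {t : ℝ} (h0 : 0 ≤ t) (h1 : t ≤ 1) :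
    objective τ lam x y (β + t • Δ) ≤ objective τ lam x y β := by
  have hrho : ∀ k i, rho (τ k) (y i - linPred (x i) (β + t • Δ) k) ≤
      (1 - t) * rho (τ k) (y i - linPred (x i) β k)
        + t * rho (τ k) (y i - linPred (x i) (β + Δ) k) := fun k i => by
    have e : y i - linPred (x i) (β + t • Δ) k = (1 - t) * (y i - linPred (x i) β k)
        + t * (y i - linPred (x i) (β + Δ) k) := by
      have e1 : ∀ c : ℝ, linPred (x i) (β + c • Δ) k = linPred (x i) β k + c * linPred (x i) Δ k :=
        fun c => by
          simp only [linPred, PiLp.add_apply, PiLp.smul_apply, smul_eq_mul, mul_add,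
            Finset.sum_add_distrib, Finset.mul_sum]
          congr 1
          exact Finset.sum_congr rfl fun _ _ => by ring
      have e2 := e1 1
      rw [one_smul] at e2
      rw [e1, e2]
      ring
    rw [e]
    simp only [rho_eq_max]
    have h1t := sub_nonneg.2 h1
    set u := y i - linPred (x i) β k
    set v := y i - linPred (x i) (β + Δ) k
    refine max_le ?_ ?_
    · nlinarith [mul_le_mul_of_nonneg_left (le_max_left (τ k * u) ((τ k - 1) * u)) h1t,
        mul_le_mul_of_nonneg_left (le_max_left (τ k * v) ((τ k - 1) * v)) h0]
    · nlinarith [mul_le_mul_of_nonneg_left (le_max_right (τ k * u) ((τ k - 1) * u)) h1t,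
        mul_le_mul_of_nonneg_left (le_max_right (τ k * v) ((τ k - 1) * v)) h0]
  have hgrp : ∀ j : Fin p, ‖group (β + t • Δ) j.succ‖ ≤
      (1 - t) * ‖group β j.succ‖ + t * ‖group (β + Δ) j.succ‖ := fun j => by
    have e : group (β + t • Δ) j.succ = (1 - t) • group β j.succ + t • group (β + Δ) j.succ := by
      rw [group_add, group_add, group_smul, smul_add, ← add_assoc, ← add_smul, sub_add_cancel,
        one_smul]
    rw [e]
    refine (norm_add_le _ _).trans (le_of_eq ?_)
    rw [norm_smul, norm_smul, Real.norm_of_nonneg h0, Real.norm_of_nonneg (sub_nonneg.2 h1)]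
  have hconv : objective τ lam x y (β + t • Δ) ≤
      (1 - t) * objective τ lam x y β + t * objective τ lam x y (β + Δ) := by
    have a1 := Finset.sum_le_sum fun k (_ : k ∈ Finset.univ) =>
      Finset.sum_le_sum fun i (_ : i ∈ Finset.univ) => hrho k i
    have a2 := Finset.sum_le_sum fun j (_ : j ∈ Finset.univ) => hgrp j
    simp only [Finset.sum_add_distrib, ← Finset.mul_sum] at a1 a2
    have a3 := mul_le_mul_of_nonneg_left a1 (show (0 : ℝ) ≤ 1 / n by positivity)
    have a4 := mul_le_mul_of_nonneg_left a2 hlam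
    unfold objective
    nlinarith
  nlinarith

lemma neg_sum_mul_score_le_excessLoss {d : ℕ} (τ : ℝ) (β δ : Fin d → ℝ) (z : (Fin d → ℝ) × ℝ) :
    -∑ j, δ j * score τ β j z ≤ excessLoss τ β δ z := by
  have h := checkRemainder_nonneg τ (z.2 - z.1 ⬝ᵥ β) (z.1 ⬝ᵥ δ)
  have e : ∑ j, δ j * score τ β j z =
      (z.1 ⬝ᵥ δ) * (τ - if z.2 - z.1 ⬝ᵥ β < 0 then 1 else 0) := by
    simp only [score, dotProduct, Finset.sum_mul]
    exact Finset.sum_congr rfl fun _ _ => by ring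
  rw [e]
  unfold checkRemainder at h
  unfold excessLoss
  linarith

/-- If `lam` dominates twice the empirical score, every `βstar + Δ` at least as good as `βstar`
has its error `Δ` in the cone. The unpenalized intercept only enters through the score term, which
is why it is counted among the active groups. -/
lemma mem_cone_of_objective_le {n K p : ℕ} (hn : 0 < n) {τ : Fin K → ℝ} {lam : ℝ} (hlam : 0 < lam)
    {x : Fin n → Fin (p + 1) → ℝ} {y : Fin n → ℝ} {βstar Δ : Coef K p}
    (hobj : objective τ lam x y (βstar + Δ) ≤ objective τ lam x y βstar) {κ : ℝ} (hκ : 0 ≤ κ)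
    (hκlam : κ * Real.sqrt K ≤ lam / 2)
    (hscore : ∀ k j, |∑ i, score (τ k) (block βstar k).ofLp j (x i, y i)| ≤ n * κ) :
    Δ ∈ cone βstar := by
  have hn' : (0 : ℝ) < n := by exact_mod_cast hn
  have hloss : -(n * (lam / 2) * ∑ j, ‖group Δ j‖) ≤
      ∑ k, ∑ i, excessLoss (τ k) (block βstar k).ofLp (block Δ k).ofLp (x i, y i) := by
    calc -(n * (lam / 2) * ∑ j, ‖group Δ j‖) ≤ -∑ j, ∑ k, |Δ (k, j)| * (n * κ) := by
          rw [Finset.mul_sum, neg_le_neg_iff]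
          refine Finset.sum_le_sum fun j _ => ?_
          rw [← Finset.sum_mul]
          have e1 := sum_abs_le_sqrt_mul_norm_group Δ j
          have e2 := mul_le_mul_of_nonneg_right e1 (show 0 ≤ n * κ by positivity)
          have e3 := mul_le_mul_of_nonneg_right hκlam
            (show 0 ≤ n * ‖group Δ j‖ by positivity)
          nlinarith
      _ ≤ -∑ j, ∑ k, Δ (k, j) * ∑ i, score (τ k) (block βstar k).ofLp j (x i, y i) := by
          rw [neg_le_neg_iff]
          refine Finset.sum_le_sum fun j _ => Finset.sum_le_sum fun k _ => ?_
          refine (le_abs_self _).trans ?_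
          rw [abs_mul]
          exact mul_le_mul_of_nonneg_left (hscore k j) (abs_nonneg _)
      _ = ∑ k, ∑ i, -∑ j, (block Δ k).ofLp j * score (τ k) (block βstar k).ofLp j (x i, y i) := by
          rw [Finset.sum_comm, ← Finset.sum_neg_distrib]
          refine Finset.sum_congr rfl fun k _ => ?_
          rw [Finset.sum_neg_distrib, Finset.sum_comm (s := (Finset.univ : Finset (Fin n)))]
          simp only [Finset.mul_sum]
          rfl
      _ ≤ _ := Finset.sum_le_sum fun k _ => Finset.sum_le_sum fun i _ =>
          neg_sum_mul_score_le_excessLoss _ _ _ _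
  have hdiff := objective_add_sub τ lam x y βstar Δ
  have hpen := mul_le_mul_of_nonneg_left (penalty_sub_ge βstar Δ) hlam.le
  have hloss' := mul_le_mul_of_nonneg_left hloss (show (0 : ℝ) ≤ 1 / n by positivity)
  have e : 1 / (n : ℝ) * -(n * (lam / 2) * ∑ j, ‖group Δ j‖) =
      -(lam / 2 * ∑ j, ‖group Δ j‖) := by field_simp
  rw [e, ← Finset.sum_add_sum_compl (activeSetBar βstar)] at hloss'
  change ∑ j ∈ (activeSetBar βstar)ᶜ, ‖group Δ j‖ ≤ 3 * ∑ j ∈ activeSetBar βstar, ‖group Δ j‖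
  refine le_of_mul_le_mul_left (a := lam) ?_ hlam
  nlinarith

/-- The basic inequality. An error longer than `r` is shortened to length `r` by convexity; there
the curvature of the expected loss `G` cannot exceed the deviation of the empirical loss plus the
penalty. -/
lemma curvature_le_of_objective_le {n K p : ℕ} (hn : 0 < n) {τ : Fin K → ℝ} {lam : ℝ}
    (hlam : 0 ≤ lam) {x : Fin n → Fin (p + 1) → ℝ} {y : Fin n → ℝ} {βstar Δ : Coef K p}
    (hobj : objective τ lam x y (βstar + Δ) ≤ objective τ lam x y βstar)
    (hcone : Δ ∈ cone βstar) {r : ℝ} (hr : 0 < r) (hrΔ : r < ‖Δ‖)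
    {G : Fin K → (Fin (p + 1) → ℝ) → ℝ} {a c : ℝ}
    (hdev : ∀ k δ, ∑ j, |δ j| ≤ 4 * (Real.sqrt ((activeSet βstar).card + 1) * r) →
      ∑ i, (G k δ - excessLoss (τ k) (block βstar k).ofLp δ (x i, y i)) ≤ n * a)
    (hcurv : ∀ Δ' ∈ cone βstar, ‖Δ'‖ ≤ r → ∀ k, c * ‖block Δ' k‖ ^ 2 ≤ G k (block Δ' k).ofLp) :
    c * r ^ 2 ≤ K * a + lam * (Real.sqrt ((activeSet βstar).card + 1) * r) := by
  have hn' : (0 : ℝ) < n := by exact_mod_cast hn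
  have hΔ0 : 0 < ‖Δ‖ := hr.trans hrΔ
  set t := r / ‖Δ‖ with ht
  have ht0 : 0 ≤ t := by positivity
  set D := t • Δ with hD
  have hDn : ‖D‖ = r := by
    rw [hD, norm_smul, Real.norm_of_nonneg ht0, ht, div_mul_cancel₀ _ hΔ0.ne']
  have hDc : D ∈ cone βstar := smul_mem_cone hcone ht0
  have hDobj : objective τ lam x y (βstar + D) ≤ objective τ lam x y βstar :=
    objective_segment_le τ hlam x y hobj ht0 ((div_le_one hΔ0).2 hrΔ.le)
  have hdiff := objective_add_sub τ lam x y βstar D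
  have hl1 := sum_norm_group_le_of_mem_cone hDc
  rw [hDn] at hl1
  have hk : ∀ k, n * (c * ‖block D k‖ ^ 2 - a) ≤
      ∑ i, excessLoss (τ k) (block βstar k).ofLp (block D k).ofLp (x i, y i) := fun k => by
    have h1 := hdev k (block D k).ofLp ((sum_abs_block_le D k).trans hl1)
    have h2 := mul_le_mul_of_nonneg_left (hcurv D hDc hDn.le k) hn'.le
    rw [Finset.sum_sub_distrib, Finset.sum_const, Finset.card_univ, Fintype.card_fin,
      nsmul_eq_mul] at h1
    linarith
  have hsum := Finset.sum_le_sum fun k (_ : k ∈ Finset.univ) => hk k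
  rw [← Finset.mul_sum, Finset.sum_sub_distrib, ← Finset.mul_sum, sum_sq_norm_block, hDn,
    Finset.sum_const, Finset.card_univ, Fintype.card_fin, nsmul_eq_mul] at hsum
  have hsum' := mul_le_mul_of_nonneg_left hsum (show (0 : ℝ) ≤ 1 / n by positivity)
  rw [← mul_assoc, one_div_mul_cancel hn'.ne', one_mul] at hsum'
  have hS := sum_norm_group_activeSetBar_le βstar D
  rw [hDn] at hS
  have hSc : 0 ≤ ∑ j ∈ (activeSetBar βstar)ᶜ, ‖group D j‖ :=
    Finset.sum_nonneg fun _ _ => norm_nonneg _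
  have hpen := mul_le_mul_of_nonneg_left
    ((show -(Real.sqrt ((activeSet βstar).card + 1) * r) ≤ _ by linarith).trans
      (penalty_sub_ge βstar D)) hlam
  linarith

/-! ### Curvature on the cone -/

lemma integral_sq_dotProduct {Ω : Type*} [MeasurableSpace Ω] {μ : Measure Ω}
    [IsProbabilityMeasure μ] {p : ℕ} {X : Ω → Fin (p + 1) → ℝ} (hX : Measurable X) {C : ℝ}
    (hC : ∀ᵐ ω ∂μ, ∀ j, |X ω j| ≤ C) (v : Fin (p + 1) → ℝ) :
    v ⬝ᵥ (secondMoment μ X *ᵥ v) = ∫ ω, (X ω ⬝ᵥ v) ^ 2 ∂μ := by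
  have hi : ∀ a b, Integrable (fun ω => X ω a * X ω b) μ := fun a b => by
    refine Integrable.of_bound (C := C * C)
      (by fun_prop : Measurable fun ω => X ω a * X ω b).aestronglyMeasurable ?_
    filter_upwards [hC] with ω hω
    rw [norm_mul]
    exact mul_le_mul (hω a) (hω b) (norm_nonneg _) ((abs_nonneg _).trans (hω a))
  have e : ∀ ω, (X ω ⬝ᵥ v) ^ 2 = ∑ a, ∑ b, v a * v b * (X ω a * X ω b) := fun ω => by
    rw [sq, dotProduct, Finset.sum_mul_sum]
    exact Finset.sum_congr rfl fun _ _ => Finset.sum_congr rfl fun _ _ => by ring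
  simp_rw [e]
  rw [integral_finsetSum _ fun a _ => integrable_finsetSum _ fun b _ => (hi a b).const_mul _]
  simp only [dotProduct, Matrix.mulVec, secondMoment, Matrix.of_apply, Finset.mul_sum]
  refine Finset.sum_congr rfl fun a _ => ?_
  rw [integral_finsetSum _ fun b _ => (hi a b).const_mul _]
  refine Finset.sum_congr rfl fun b _ => ?_
  rw [integral_const_mul]
  ring

/-- Restricted strong convexity of the expected loss. Within distance `dt` of the truth the
nonlinearity condition makes the cubic error at most a third of the quadratic term. -/
theorem curvature_on_cone {Ω : Type*} [MeasurableSpace Ω] {μ : Measure Ω}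
    [IsProbabilityMeasure μ] {n K p : ℕ} {τ : Fin K → ℝ} {βstar : Coef K p}
    {x : Fin n → Ω → Fin (p + 1) → ℝ} {y : Fin n → Ω → ℝ} {c₁ c₂ Cx bt Bt dt : ℝ}
    (hc₁ : 0 < c₁) (hc₂ : 0 < c₂) (hbt : 0 < bt) (hdt : 0 < dt) {b B : Fin K → ℝ}
    (hx : ∀ i, Measurable (x i)) (hy : ∀ i, Measurable (y i))
    (hmodel : IsQuantileModel μ τ βstar x y) (hdens : DensityCondition μ βstar x y c₁ c₂)
    (hbdd : BoundedCondition μ x Cx) (heig : EigenvalueCondition μ βstar x b B bt Bt)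
    (hnonlin : NonlinearityCondition μ βstar x B c₁ c₂ dt) (i : Fin n) {Δ : Coef K p}
    (hΔ : Δ ∈ cone βstar) (hΔr : ‖Δ‖ ≤ dt) (k : Fin K) :
    c₁ * bt / 3 * ‖block Δ k‖ ^ 2 ≤
      ∫ ω, excessLoss (τ k) (block βstar k).ofLp (block Δ k).ofLp (x i ω, y i ω) ∂μ := by
  by_cases hv : block Δ k = 0
  · simp [hv, excessLoss_zero]
  have hC : ∀ᵐ ω ∂μ, ∀ j, |x i ω j| ≤ Cx := by
    rw [ae_all_iff]
    exact fun j => (hbdd i j).mono fun ω h => h.le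
  have hexc := le_integral_excessLoss (hx i) (hy i) (β := (block βstar k).ofLp) (hmodel.2.2 i k) hC
    (c₁ := c₁) (c₂ := c₂)
    (by
      filter_upwards [hdens i] with ω ⟨f, h0, h1, h2, h3, h4⟩
      exact ⟨f, h0, h1, h2, h3, h4 k⟩) (block Δ k).ofLp
  obtain ⟨hb, -, heig'⟩ := heig i k
  obtain ⟨hlo, hhi⟩ := heig' _ ⟨Δ, hΔ, rfl⟩ hv
  simp only [integral_sq_dotProduct (hx i) hC] at hlo hhi
  have hnl := hnonlin i k Δ hΔ hv
  simp only [linPred_eq_dotProduct] at hnl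
  set m := ∫ ω, (x i ω ⬝ᵥ (block Δ k).ofLp) ^ 2 ∂μ with hm
  set T := ∫ ω, |x i ω ⬝ᵥ (block Δ k).ofLp| ^ 3 ∂μ with hT
  have hN : 0 < ‖block Δ k‖ := norm_pos_iff.2 hv
  have hm0 : 0 < m := lt_of_lt_of_le (mul_pos (hbt.trans_le hb) (by positivity)) hlo
  have hB : 0 < B k := pos_of_mul_pos_left (hm0.trans_le hhi) (by positivity)
  have hT0 : 0 < T := by
    refine lt_of_le_of_ne (integral_nonneg fun ω => by positivity) fun h => ?_
    rw [← h, div_zero, mul_zero] at hnl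
    exact absurd hnl (not_le.2 hdt)
  have hsqrt : Real.sqrt m ≤ Real.sqrt (B k) * dt := by
    refine (Real.sqrt_le_sqrt hhi).trans ?_
    rw [Real.sqrt_mul hB.le, Real.sqrt_sq hN.le]
    exact mul_le_mul_of_nonneg_left ((norm_block_le Δ k).trans hΔr) (Real.sqrt_nonneg _)
  have hpow : m ^ (3 / 2 : ℝ) = m * Real.sqrt m := by
    rw [show (3 / 2 : ℝ) = 1 + 1 / 2 by norm_num, Real.rpow_add hm0, Real.rpow_one,
      Real.sqrt_eq_rpow]
  have hsB : 0 < Real.sqrt (B k) := Real.sqrt_pos.2 hB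
  have hcub : c₂ * T ≤ c₁ * m := by
    rw [hpow, div_mul_div_comm, le_div_iff₀ (by positivity)] at hnl
    have h1 := mul_le_mul_of_nonneg_left hsqrt (mul_pos hc₁ hm0).le
    refine le_of_mul_le_mul_right (a := Real.sqrt (B k) * dt) ?_ (by positivity)
    nlinarith
  have h2 : bt * ‖block Δ k‖ ^ 2 ≤ m :=
    (mul_le_mul_of_nonneg_right hb (by positivity)).trans hlo
  have h3 := mul_le_mul_of_nonneg_left h2 hc₁.le
  linarith

/-! ### The error bound for a fixed sample size -/

/-- The uniform deviation bound, transferred to the given sample by its independence. -/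
lemma measure_sample_deviation_le {Ω : Type*} [MeasurableSpace Ω] {μ : Measure Ω}
    [IsProbabilityMeasure μ] {n p : ℕ} {x : Fin n → Ω → Fin (p + 1) → ℝ} {y : Fin n → Ω → ℝ}
    (hsample : IsIIDSample μ x y) (i₀ : Fin n) {Cx : ℝ} (hCx : 0 < Cx)
    (hbdd : BoundedCondition μ x Cx) {τ : ℝ} (h0 : 0 ≤ τ) (h1 : τ ≤ 1) (β : Fin (p + 1) → ℝ)
    {L a : ℝ} (hL : 0 ≤ L) (ha : 0 < a) :
    μ {ω | ∃ δ : Fin (p + 1) → ℝ, ∑ j, |δ j| ≤ L ∧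
        a < ∑ i, (∫ ω', excessLoss τ β δ (x i₀ ω', y i₀ ω') ∂μ
          - excessLoss τ β δ (x i ω, y i ω))} ≤
      ENNReal.ofReal
        (2 * L * (Cx * Real.sqrt (2 * n * Real.log (2 * (p + 1 : ℕ)))) / a) := by
  obtain ⟨hx, hy, hind, hid, -⟩ := hsample
  have hz : ∀ i, Measurable fun ω => (x i ω, y i ω) := fun i => (hx i).prodMk (hy i)
  set ν := μ.map fun ω => (x i₀ ω, y i₀ ω) with hν
  have : IsProbabilityMeasure ν := Measure.isProbabilityMeasure_map (hz i₀).aemeasurable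
  have hlaw : μ.map (fun ω i => (x i ω, y i ω)) = Measure.pi fun _ : Fin n => ν := by
    rw [(iIndepFun_iff_map_fun_eq_pi_map fun i => (hz i).aemeasurable).1 hind]
    congr 1
    funext i
    exact (hid i i₀).map_eq
  have hbν : ∀ᵐ z ∂ν, ∀ j, |z.1 j| ≤ Cx := by
    rw [hν, ae_map_iff (hz i₀).aemeasurable]
    · rw [ae_all_iff]
      exact fun j => (hbdd i₀ j).mono fun ω h => h.le
    · simp only [Set.ofPred_forall]
      exact MeasurableSet.iInter fun j => measurableSet_le (by fun_prop) measurable_const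
  have hmean : ∀ δ : Fin (p + 1) → ℝ, ∫ ω', excessLoss τ β δ (x i₀ ω', y i₀ ω') ∂μ =
      ∫ z, excessLoss τ β δ z ∂ν := fun δ =>
    (integral_map (hz i₀).aemeasurable (measurable_excessLoss τ β δ).aestronglyMeasurable).symm
  simp only [hmean]
  have hball := measure_ball_deviation_le i₀.pos h0 h1 β hCx hL hbν ha
  rw [← hlaw] at hball
  exact (Measure.le_map_apply (measurable_pi_lambda _ hz).aemeasurable _).trans hball

/-- The error exceeds `r` only where a coordinate of the score is above `κ` or, for one of the
quantiles, the empirical loss deviates by `a` from its mean on the `ℓ¹` ball that contains the cone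
vectors of length `r`. The condition `hcrit` says that the curvature at radius `r` exceeds this
deviation plus the penalty. -/
theorem measure_error_le {Ω : Type*} [MeasurableSpace Ω] {μ : Measure Ω}
    [IsProbabilityMeasure μ] {n K p : ℕ} (hn : 0 < n) {τ : Fin K → ℝ} {βstar : Coef K p}
    {x : Fin n → Ω → Fin (p + 1) → ℝ} {y : Fin n → Ω → ℝ} {c₁ c₂ Cx bt Bt dt : ℝ}
    (hc₁ : 0 < c₁) (hc₂ : 0 < c₂) (hCx : 0 < Cx) (hbt : 0 < bt) (hdt : 0 < dt) {b B : Fin K → ℝ}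
    (hsample : IsIIDSample μ x y)
    (hmodel : IsQuantileModel μ τ βstar x y) (hdens : DensityCondition μ βstar x y c₁ c₂)
    (hbdd : BoundedCondition μ x Cx) (heig : EigenvalueCondition μ βstar x b B bt Bt)
    (hnonlin : NonlinearityCondition μ βstar x B c₁ c₂ dt) {lam : ℝ} (hlam : 0 < lam)
    {βhat : Ω → Coef K p}
    (hβhat : ∀ᵐ ω ∂μ, objective τ lam (fun i => x i ω) (fun i => y i ω) (βhat ω) ≤
      objective τ lam (fun i => x i ω) (fun i => y i ω) βstar)
    {κ r a : ℝ} (hκ : 0 ≤ κ) (hκlam : κ * Real.sqrt K ≤ lam / 2) (hr : 0 < r) (hrdt : r ≤ dt)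
    (ha : 0 < a)
    (hcrit : K * a + lam * (Real.sqrt ((activeSet βstar).card + 1) * r) < c₁ * bt / 3 * r ^ 2) :
    μ {ω | r < ‖βhat ω - βstar‖} ≤
      K * ((p + 1 : ℕ) * ENNReal.ofReal (2 * Real.exp (-(2 * (n * κ) ^ 2 / (n * Cx ^ 2))))) +
      K * ENNReal.ofReal (2 * (4 * (Real.sqrt ((activeSet βstar).card + 1) * r)) *
        (Cx * Real.sqrt (2 * n * Real.log (2 * (p + 1 : ℕ)))) / (n * a)) := by
  have hn' : (0 : ℝ) < n := by exact_mod_cast hn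
  let i₀ : Fin n := ⟨0, hn⟩
  have hτ := fun k => hmodel.2.1 k
  set L := 4 * (Real.sqrt ((activeSet βstar).card + 1) * r) with hL
  let S : Fin K → Fin (p + 1) → Set Ω := fun k j =>
    {ω | n * κ ≤ |∑ i, score (τ k) (block βstar k).ofLp j (x i ω, y i ω)|}
  let D : Fin K → Set Ω := fun k => {ω | ∃ δ : Fin (p + 1) → ℝ, ∑ j, |δ j| ≤ L ∧
    n * a < ∑ i, (∫ ω', excessLoss (τ k) (block βstar k).ofLp δ (x i₀ ω', y i₀ ω') ∂μ
      - excessLoss (τ k) (block βstar k).ofLp δ (x i ω, y i ω))}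
  have hS : ∀ k j, μ (S k j) ≤
      ENNReal.ofReal (2 * Real.exp (-(2 * (n * κ) ^ 2 / (n * Cx ^ 2)))) := fun k j =>
    measure_score_ge_le hsample.1 hsample.2.1 hsample.2.2.1 (hτ k).1.le (hτ k).2.le
      (fun i => hmodel.2.2 i k) hCx.le j (fun i => (hbdd i j).mono fun ω h => h.le)
      (mul_nonneg hn'.le hκ)
  have hD : ∀ k, μ (D k) ≤ ENNReal.ofReal (2 * L *
      (Cx * Real.sqrt (2 * n * Real.log (2 * (p + 1 : ℕ)))) / (n * a)) := fun k =>
    measure_sample_deviation_le hsample i₀ hCx hbdd (hτ k).1.le (hτ k).2.le _ (by positivity)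
      (mul_pos hn' ha)
  have hsub : {ω | r < ‖βhat ω - βstar‖} ≤ᵐ[μ] ((⋃ k, ⋃ j, S k j) ∪ ⋃ k, D k : Set Ω) := by
    filter_upwards [hβhat] with ω hω hrω
    by_contra hbad
    have hbad' : ω ∉ ((⋃ k, ⋃ j, S k j) ∪ ⋃ k, D k : Set Ω) := hbad
    simp only [Set.mem_union, Set.mem_iUnion, not_or, not_exists] at hbad'
    rw [← add_sub_cancel βstar (βhat ω)] at hω
    have hcone := mem_cone_of_objective_le hn hlam hω hκ hκlam
      fun k j => (not_le.1 (hbad'.1 k j)).le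
    have hbasic := curvature_le_of_objective_le hn hlam.le hω hcone hr hrω
      (G := fun k δ => ∫ ω', excessLoss (τ k) (block βstar k).ofLp δ (x i₀ ω', y i₀ ω') ∂μ)
      (a := a) (c := c₁ * bt / 3)
      (fun k δ hδ => not_lt.1 fun h => hbad'.2 k ⟨δ, hδ, h⟩)
      (fun Δ hΔ hΔr k => curvature_on_cone hc₁ hc₂ hbt hdt hsample.1 hsample.2.1 hmodel hdens hbdd
        heig hnonlin i₀ hΔ (hΔr.trans hrdt) k)
    exact absurd hbasic (not_le.2 hcrit)
  refine (measure_mono_ae hsub).trans ((measure_union_le _ _).trans (add_le_add ?_ ?_))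
  · refine (measure_iUnion_fintype_le _ _).trans ((Finset.sum_le_sum fun k _ =>
      (measure_iUnion_fintype_le _ _).trans (Finset.sum_le_sum fun j _ => hS k j)).trans ?_)
    simp
  · refine (measure_iUnion_fintype_le _ _).trans ((Finset.sum_le_sum fun k _ => hD k).trans ?_)
    simp

/-! ### The rate -/

/-- With `r = M ρ`, where `ρ = √(s k log p / n)`, and the deviation level `a = 64 C k₀ M ρ² / ε`,
where `k₀` bounds the number `k` of quantiles, the deviation term of `measure_error_le` is at most
`ε / 2`. -/
lemma deviation_probability_le {n k p s k₀ C M ε ρ : ℝ} (hn : 0 < n) (hk : 1 ≤ k) (hkk : k ≤ k₀)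
    (hp : 3 ≤ p) (hs : 1 ≤ s) (hC : 0 < C) (hM : 0 < M) (hε : 0 < ε)
    (hρ : ρ = Real.sqrt (s * k * Real.log p / n)) :
    k * (2 * (4 * (Real.sqrt (s + 1) * (M * ρ))) *
      (C * Real.sqrt (2 * n * Real.log (2 * (p + 1)))) /
        (n * (64 * C * k₀ / ε * M * ρ ^ 2))) ≤ ε / 2 := by
  have hl : 0 < Real.log p := Real.log_pos (by linarith)
  have hk0 : 0 < k := by linarith
  have hρ2 : ρ ^ 2 = s * k * Real.log p / n := by
    rw [hρ, Real.sq_sqrt (by positivity)]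
  have hρ0 : 0 < ρ := by rw [hρ]; exact Real.sqrt_pos.2 (by positivity)
  have hlog : Real.log (2 * (p + 1)) ≤ 2 * Real.log p := by
    rw [← Real.log_rpow (by linarith)]
    refine Real.log_le_log (by linarith) ?_
    rw [Real.rpow_two]
    nlinarith
  -- `s + 1 ≤ 2 s` and `log (2 (p + 1)) ≤ 2 log p`, and `1 ≤ k` brings in `ρ`
  have hprod : Real.sqrt (s + 1) * Real.sqrt (2 * n * Real.log (2 * (p + 1))) ≤ 4 * (n * ρ) := by
    rw [← Real.sqrt_mul (by linarith)]
    refine Real.sqrt_le_iff.2 ⟨by positivity, ?_⟩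
    have e : (4 * (n * ρ)) ^ 2 = 16 * (n * (s * k * Real.log p)) := by
      rw [mul_pow, mul_pow, hρ2]; field_simp; norm_num
    rw [e]
    have e1 : (s + 1) * (2 * n * Real.log (2 * (p + 1))) ≤ (2 * s) * (2 * n * (2 * Real.log p)) := by
      have : 0 ≤ Real.log (2 * (p + 1)) := Real.log_nonneg (by linarith)
      gcongr
      linarith
    have e2 : n * (s * 1 * Real.log p) ≤ n * (s * k * Real.log p) := by gcongr
    have e3 : 0 < n * (s * 1 * Real.log p) := by positivity
    nlinarith
  have hk₀ : 0 < k₀ := by linarith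
  rw [← mul_div_assoc, div_le_iff₀ (by positivity)]
  have e4 : ε / 2 * (n * (64 * C * k₀ / ε * M * ρ ^ 2)) = 8 * C * M * ρ * k₀ * (4 * (n * ρ)) := by
    field_simp; norm_num
  rw [e4]
  calc _ = 8 * C * M * ρ * k *
        (Real.sqrt (s + 1) * Real.sqrt (2 * n * Real.log (2 * (p + 1)))) := by ring
    _ ≤ _ := by gcongr

/-- The penalty, per unit of length on the active groups, is of the order of the rate. -/
lemma lam_mul_sqrt_le {n k p s C D ρ : ℝ} (hn : 0 < n) (hk : 1 ≤ k) (hp : 3 ≤ p) (hs : 1 ≤ s)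
    (hC : 0 < C) (hD : 0 < D) (hρ : ρ = Real.sqrt (s * k * Real.log p / n)) :
    (C * Real.sqrt (k / n) + 2 * C * Real.sqrt (D * k * Real.log p / n)) * Real.sqrt (s + 1) ≤
      2 * C * (1 + 2 * Real.sqrt D) * ρ := by
  have hl : 1 ≤ Real.log p := by
    rw [Real.le_log_iff_exp_le (by linarith)]
    linarith [Real.exp_one_lt_d9]
  have hs1 : Real.sqrt (s + 1) ≤ 2 * Real.sqrt s := by
    rw [Real.sqrt_le_left (by positivity), mul_pow, Real.sq_sqrt (by linarith)]
    linarith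
  have h1 : Real.sqrt (k / n) * Real.sqrt s ≤ ρ := by
    rw [hρ, ← Real.sqrt_mul (by positivity)]
    refine Real.sqrt_le_sqrt ?_
    rw [div_mul_eq_mul_div]
    have : k * s * 1 ≤ k * s * Real.log p := by gcongr
    gcongr ?_ / n
    linarith
  have h2 : Real.sqrt (D * k * Real.log p / n) * Real.sqrt s = Real.sqrt D * ρ := by
    rw [hρ, ← Real.sqrt_mul (by positivity), ← Real.sqrt_mul hD.le]
    congr 1
    ring
  calc _ ≤ (C * Real.sqrt (k / n) + 2 * C * Real.sqrt (D * k * Real.log p / n)) *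
        (2 * Real.sqrt s) := by gcongr
    _ = 2 * C * (Real.sqrt (k / n) * Real.sqrt s)
        + 4 * C * (Real.sqrt (D * k * Real.log p / n) * Real.sqrt s) := by ring
    _ ≤ 2 * C * ρ + 4 * C * (Real.sqrt D * ρ) := by rw [h2]; gcongr
    _ = _ := by ring

/-- At the level `κ = C √(D log p / n)` each coordinate of the score has tail probability
`2 p^(-2 D)`, so that the union bound over its `k (p + 1)` coordinates is small for large `p`. -/
lemma score_probability_le {n k p k₀ C D ε : ℝ} (hn : 0 < n) (hk : 0 ≤ k) (hkk : k ≤ k₀)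
    (hp : 1 ≤ p) (hC : 0 < C) (hD : 1 < D) (hε : 0 < ε) (hpε : 8 * k₀ / ε ≤ p) :
    k * ((p + 1) * (2 * Real.exp (-(2 * (n * (C * Real.sqrt (D * Real.log p / n))) ^ 2
      / (n * C ^ 2))))) ≤ ε / 2 := by
  have hl : 0 ≤ Real.log p := Real.log_nonneg hp
  have e1 : 2 * (n * (C * Real.sqrt (D * Real.log p / n))) ^ 2 / (n * C ^ 2) =
      2 * D * Real.log p := by
    rw [mul_pow, mul_pow, Real.sq_sqrt (by positivity)]
    field_simp
  have hp0 : 0 < p := by linarith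
  have e2 : Real.exp (-(2 * D * Real.log p)) ≤ (p ^ 2)⁻¹ := by
    rw [← Real.exp_log (show 0 < (p ^ 2)⁻¹ by positivity), Real.log_inv, Real.log_pow,
      Real.exp_le_exp]
    push_cast
    nlinarith
  rw [e1]
  have hk₀ : 0 ≤ k₀ := hk.trans hkk
  calc k * ((p + 1) * (2 * Real.exp (-(2 * D * Real.log p))))
      ≤ k₀ * ((p + p) * (2 * (p ^ 2)⁻¹)) := by gcongr
    _ = 4 * k₀ / p := by field_simp; ring
    _ ≤ ε / 2 := by
      rw [div_le_iff₀ hε] at hpε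
      rw [div_le_iff₀ hp0]
      linarith

end GQLasso

theorem corollary1
    {Ω : ℕ → Type*} [∀ n, MeasurableSpace (Ω n)]
    (μ : ∀ n, Measure (Ω n)) [∀ n, IsProbabilityMeasure (μ n)]
    -- number of predictors, number of quantiles, quantile levels, true coefficients
    (p K : ℕ → ℕ) (τ : ∀ n, Fin (K n) → ℝ) (βstar : ∀ n, GQLasso.Coef (K n) (p n))
    -- the sample of size n, for each n
    (x : ∀ n, Fin n → Ω n → Fin (p n + 1) → ℝ) (y : ∀ n, Fin n → Ω n → ℝ)
    -- constants that do not depend on n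
    (c₁ c₂ Cx bt Bt dt D₂ : ℝ)
    (hc₁ : 0 < c₁) (hc₂ : 0 < c₂) (hCx : 0 < Cx) (hbt : 0 < bt) (hBt : 0 < Bt) (hdt : 0 < dt)
    (hD₂ : 1 < D₂)
    (b B : ∀ n, Fin (K n) → ℝ)
    -- the model and the conditions
    (hsample : ∀ n, GQLasso.IsIIDSample (μ n) (x n) (y n))
    (hmodel : ∀ n, GQLasso.IsQuantileModel (μ n) (τ n) (βstar n) (x n) (y n))
    (hdens : ∀ n, GQLasso.DensityCondition (μ n) (βstar n) (x n) (y n) c₁ c₂)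
    (hbdd : ∀ n, GQLasso.BoundedCondition (μ n) (x n) Cx)
    (heig : ∀ n, GQLasso.EigenvalueCondition (μ n) (βstar n) (x n) (b n) (B n) bt Bt)
    (hnonlin : ∀ n, GQLasso.NonlinearityCondition (μ n) (βstar n) (x n) (B n) c₁ c₂ dt)
    -- the tuning parameter and the estimator
    (lam : ℕ → ℝ)
    (hlam : ∀ n, lam n = Cx * Real.sqrt ((K n : ℝ) / n)
      + 2 * Cx * Real.sqrt (D₂ * (K n : ℝ) * Real.log (p n) / n))
    (βhat : ∀ n, Ω n → GQLasso.Coef (K n) (p n))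
    (hβhat : ∀ n, ∀ᵐ ω ∂(μ n), ∀ β : GQLasso.Coef (K n) (p n),
      GQLasso.objective (τ n) (lam n) (fun i => x n i ω) (fun i => y n i ω) (βhat n ω) ≤
        GQLasso.objective (τ n) (lam n) (fun i => x n i ω) (fun i => y n i ω) β)
    -- the asymptotic regime, with s the number of active predictors
    (s : ℕ → ℕ) (hs : ∀ n, s n = (GQLasso.activeSet (βstar n)).card)
    (hs_pos : ∀ᶠ n in atTop, 1 ≤ s n)
    (hp : Tendsto p atTop atTop)
    (hslogp : (fun n => (s n : ℝ) * Real.log (p n)) =o[atTop] (fun n => (n : ℝ)))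
    (hK : (fun n => (K n : ℝ)) =O[atTop] (fun _ => (1 : ℝ))) :
    GQLasso.IsBigOP μ (fun n ω => ‖βhat n ω - βstar n‖)
      (fun n => Real.sqrt ((s n : ℝ) * (K n : ℝ) * Real.log (p n) / n)) := by
  intro ε hε
  obtain ⟨k₀, hk₀⟩ := hK.bound
  simp only [norm_one, mul_one, Real.norm_natCast] at hk₀
  set k₁ := max k₀ 1 with hk₁
  have hk₁0 : 0 < k₁ := lt_max_of_lt_right one_pos
  -- the curvature `c₁ bt / 3` must beat the deviation level and the penalty, both linear in `M`
  set A := 64 * Cx * k₁ / ε with hA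
  set Q := k₁ * A + 2 * Cx * (1 + 2 * Real.sqrt D₂) with hQ
  have hA0 : 0 < A := by positivity
  have hQ0 : 0 < Q := by positivity
  set c := c₁ * bt / 3 with hc
  have hc0 : 0 < c := by positivity
  set M := Q / c + 1 with hM
  have hM0 : 0 < M := by positivity
  have hQM : Q < c * M := by
    rw [hM, mul_add, mul_div_cancel₀ _ hc0.ne']; linarith
  refine ⟨M, hM0, ?_⟩
  have hsmall := hslogp.def (show 0 < (dt / M) ^ 2 / k₁ by positivity)
  filter_upwards [hk₀, hs_pos, hsmall, hp.eventually_ge_atTop 3,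
    hp.eventually_ge_atTop ⌈8 * k₁ / ε⌉₊, eventually_gt_atTop 0] with n hkn hsn hsmn hp3 hpε hn
  have hn' : (0 : ℝ) < n := by exact_mod_cast hn
  have hk1 : (K n : ℝ) ≤ k₁ := hkn.trans (le_max_left _ _)
  have hp3' : (3 : ℝ) ≤ p n := by exact_mod_cast hp3
  have hs' : (1 : ℝ) ≤ s n := by exact_mod_cast hsn
  have hpε' : 8 * k₁ / ε ≤ p n := (Nat.le_ceil _).trans (by exact_mod_cast hpε)
  have hl : 0 < Real.log (p n) := Real.log_pos (by linarith)
  -- an active predictor can only exist when there is at least one quantile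
  have hKpos : (1 : ℝ) ≤ K n := by
    have hne : 0 < (GQLasso.activeSet (βstar n)).card := by rw [← hs n]; exact hsn
    obtain ⟨j, hj⟩ := Finset.card_pos.1 hne
    rw [GQLasso.activeSet, Finset.mem_filter] at hj
    have : K n ≠ 0 := fun h => by
      have : IsEmpty (Fin (K n)) := by rw [h]; infer_instance
      exact hj.2.2 (by simp [EuclideanSpace.norm_eq])
    exact_mod_cast Nat.one_le_iff_ne_zero.2 this
  set ρ := Real.sqrt ((s n : ℝ) * (K n : ℝ) * Real.log (p n) / n) with hρ
  have hρ0 : 0 < ρ := Real.sqrt_pos.2 (by positivity)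
  have hr : M * ρ ≤ dt := by
    rw [← le_div_iff₀' hM0, hρ, Real.sqrt_le_left (by positivity), div_le_iff₀ hn']
    rw [Real.norm_of_nonneg (by positivity), Real.norm_of_nonneg hn'.le] at hsmn
    calc (s n : ℝ) * K n * Real.log (p n) = K n * (s n * Real.log (p n)) := by ring
      _ ≤ k₁ * ((dt / M) ^ 2 / k₁ * n) := by gcongr
      _ = _ := by field_simp
  have hlam0 : 0 < lam n := by
    rw [hlam n]
    have : 0 < Real.sqrt ((K n : ℝ) / n) := Real.sqrt_pos.2 (by positivity)
    positivity
  have hlamS := GQLasso.lam_mul_sqrt_le hn' hKpos hp3' hs' hCx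
    (show 0 < D₂ by linarith) hρ
  rw [← hlam n] at hlamS
  have hscard : ((GQLasso.activeSet (βstar n)).card : ℝ) = s n := by rw [hs n]
  have hmain := GQLasso.measure_error_le hn hc₁ hc₂ hCx hbt hdt (hsample n) (hmodel n) (hdens n)
    (hbdd n) (heig n) (hnonlin n) hlam0 ((hβhat n).mono fun ω h => h (βstar n))
    (κ := Cx * Real.sqrt (D₂ * Real.log (p n) / n)) (r := M * ρ) (a := A * M * ρ ^ 2)
    (by positivity)
    (by
      rw [hlam n, mul_assoc, ← Real.sqrt_mul (by positivity)]
      have e : D₂ * Real.log (p n) / n * K n = D₂ * K n * Real.log (p n) / n := by ring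
      have : 0 ≤ Cx * Real.sqrt ((K n : ℝ) / n) := by positivity
      rw [e]
      linarith)
    (by positivity) hr (by positivity)
    (by
      rw [hscard]
      have e1 : K n * (A * M * ρ ^ 2) ≤ k₁ * (A * M * ρ ^ 2) := by gcongr
      have e2 : lam n * (Real.sqrt (s n + 1) * (M * ρ)) ≤
          2 * Cx * (1 + 2 * Real.sqrt D₂) * ρ * (M * ρ) := by
        rw [← mul_assoc]; gcongr
      have e3 : Q * (M * ρ ^ 2) < c * M * (M * ρ ^ 2) := by gcongr
      calc _ ≤ k₁ * (A * M * ρ ^ 2) + 2 * Cx * (1 + 2 * Real.sqrt D₂) * ρ * (M * ρ) :=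
            add_le_add e1 e2
        _ = Q * (M * ρ ^ 2) := by rw [hQ]; ring
        _ < c * M * (M * ρ ^ 2) := e3
        _ = _ := by ring)
  rw [hscard] at hmain
  simp only [abs_norm]
  refine hmain.trans ?_
  have hscore := GQLasso.score_probability_le hn' (by linarith) hk1 (by linarith) hCx hD₂ hε hpε'
  have hdev := GQLasso.deviation_probability_le hn' hKpos hk1 hp3' hs' hCx hM0 hε hρ
  have hcast : ∀ m : ℕ, (m : ℝ≥0∞) = ENNReal.ofReal m := fun m => (ENNReal.ofReal_natCast m).symm
  rw [hcast (K n), hcast (p n + 1), ← ENNReal.ofReal_mul (by positivity),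
    ← ENNReal.ofReal_mul (by positivity), ← ENNReal.ofReal_mul (by positivity)]
  push_cast
  refine (add_le_add (ENNReal.ofReal_le_ofReal hscore) (ENNReal.ofReal_le_ofReal hdev)).trans ?_
  rw [← ENNReal.ofReal_add (by positivity) (by positivity), add_halves]
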